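/- Let $C$ be a set of $m\ge 2$ candidates and $V$ a finite set of voters, each voter $v$ having a linear order $\succ_v$ over $C$ as vote. A scoring vector is $\alpha=(\alpha_1,\dots,\alpha_m)\in\mathbb{R}^m$ with $\alpha_1\ge\dots\ge\alpha_m$ and $\alpha_1>\alpha_m$. A candidate gets $\alpha_i$ points from each vote that ranks it in position $i$; the scoring rule $r$ of $\alpha$ selects, among the candidates with maximum total score, the one that comes first in a fixed linear order $\succ_t$ over $C$. Let $P$ be a profile with current winner $x=r(P)$. For a candidate $y\ne x$, a set $M\subseteq V$ is a coalition of possible manipulators against $y$ if there are votes $(\succ'_j)_{j\in M}$, each ranking $x$ above $y$, such that $y$ wins under $r$ when the votes of the members of $M$ in $P$ are replaced by them (for $y=x$ no set is one). $M$ is a coalition of possible manipulators if it is one against some candidate $y$. CPMW is the problem to decide, given a scoring rule (a scoring vector with rational entries in binary and an order $\succ_t$), a profile, a set $M$ of voters and a candidate $y$, whether $M$ is a coalition of possible manipulators against $y$. CPM is the problem to decide, given the same data without $y$, whether $M$ is a coalition of possible manipulators. There is no bound on $m$, $|V|$ or $|M|$. **Theorem.** Consider scoring vectors with $\alpha_1-\alpha_2\le\alpha_i-\alpha_{i+1}$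 for all $1\le i<m$. (1) For every real scoring vector of this kind, every $\succ_t$, every profile with current winner $x$, every $M\subseteq V$ and every candidate $y\neq x$: $M$ is a coalition of possible manipulators against $y$ if and only if $y$ wins in the profile obtained by moving, in the vote of every member of $M$, $x$ to the first and $y$ to the second position while keeping the relative order of the other candidates. (2) Restricted to the scoring rules of this kind, CPMW and CPM are in $\mathsf{P}$. (3) For every $m\ge2$ the Borda vector $(m-1,m-2,\dots,1,0)$ is a scoring vector of this kind. -/

import Mathlib

/-! ### Elections and positional scoring rules -/

/-- A preference (linear order) over a set `C` of `m` candidates, given by the position of each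
candidate: position `0` is the most preferred one, position `m - 1` the least preferred one. -/
abbrev Preference (C : Type*) (m : ℕ) := C ≃ Fin m

/-- The voter with preference `p` strictly prefers `a` to `b`. -/
def Preference.Prefers {C : Type*} {m : ℕ} (p : Preference C m) (a b : C) : Prop := p a < p b

/-- Move the candidate `c` to the top of the preference `p`; the relative order of all other
candidates is unchanged. -/
def Preference.moveToTop {C : Type*} {m : ℕ} (p : Preference C m) (c : C) : Preference C m :=
  p.trans (Fin.cycleRange (p c))

/-- A preference profile of the voters `V`. -/
abbrev Profile (V C : Type*) (m : ℕ) := V → Preference C m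

/-- A (resolute) voting rule for the voters `V` and the candidates `C`. -/
abbrev VotingRule (V C : Type*) (m : ℕ) := Profile V C m → C

/-- `α₁ ≥ α₂ ≥ ⋯ ≥ α_m` and `α₁ > α_m` (positions are counted from `0` here). -/
structure IsScoringVector {m : ℕ} (α : Fin m → ℝ) : Prop where
  two_le : 2 ≤ m
  antitone : Antitone α
  last_lt_first : α ⟨m - 1, by omega⟩ < α ⟨0, by omega⟩

/-- `α₁ - α₂ ≤ αᵢ - αᵢ₊₁` for all `i` (positions are counted from `0` here). -/
def FirstGapMinimal {m : ℕ} (α : Fin m → ℝ) : Prop :=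
  ∀ (i : ℕ) (hi : i + 1 < m),
    α ⟨0, by omega⟩ - α ⟨1, by omega⟩ ≤ α ⟨i, by omega⟩ - α ⟨i + 1, hi⟩

/-- The Borda vector `(m - 1, m - 2, …, 1, 0)`. -/
def bordaVector (m : ℕ) : Fin m → ℝ := fun i => (m : ℝ) - 1 - (i : ℕ)

/-- The total score of a candidate. -/
def totalScore {V C : Type*} [Fintype V] {m : ℕ} (α : Fin m → ℝ) (P : Profile V C m) (c : C) : ℝ :=
  ∑ v, α (P v c)

open Classical in
/-- The voting correspondence of a scoring rule: the candidates with maximum score. -/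
noncomputable def topScorers {V C : Type*} [Fintype V] [Fintype C] {m : ℕ} (α : Fin m → ℝ)
    (P : Profile V C m) : Finset C :=
  Finset.univ.filter fun c => ∀ d, totalScore α P d ≤ totalScore α P c

theorem topScorers_nonempty {V C : Type*} [Fintype V] [Fintype C] [Nonempty C] {m : ℕ}
    (α : Fin m → ℝ) (P : Profile V C m) : (topScorers α P).Nonempty := by
  obtain ⟨c, hc⟩ := Finite.exists_max (totalScore α P)
  exact ⟨c, by simpa [topScorers] using hc⟩

/-- Lexicographic tie breaking: the member of `S` that is most preferred in the order `t`. -/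
def lexTieBreak {C : Type*} {m : ℕ} (t : Preference C m) (S : Finset C) (hS : S.Nonempty) : C :=
  t.symm ((S.map t.toEmbedding).min' (by simpa using hS))

/-- The scoring rule of the vector `α` with lexicographic tie breaking according to `t`. -/
noncomputable def scoringRule {V C : Type*} [Fintype V] [Fintype C] [Nonempty C] {m : ℕ}
    (α : Fin m → ℝ) (t : Preference C m) : VotingRule V C m :=
  fun P => lexTieBreak t (topScorers α P) (topScorers_nonempty α P)

/-! ### Coalitions of possible manipulators -/

open Classical in
/-- The profile `P` with the votes of the voters in `M` replaced by those of `Q`. -/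
noncomputable def replaceVotes {V C : Type*} {m : ℕ} (P : Profile V C m) (M : Finset V)
    (Q : Profile {v // v ∈ M} C m) : Profile V C m :=
  fun v => if h : v ∈ M then Q ⟨v, h⟩ else P v

/-- `M` is a coalition of possible manipulators against `y`: the candidate `y` is not the current
winner `r P`, and the voters in `M` have preferences that all prefer the current winner to `y` and
with which `y` would have won. -/
def IsCoalitionAgainst {V C : Type*} {m : ℕ} (r : VotingRule V C m) (P : Profile V C m)
    (M : Finset V) (y : C) : Prop :=
  y ≠ r P ∧ ∃ Q : Profile {v // v ∈ M} C m,
    (∀ j, (Q j).Prefers (r P) y) ∧ r (replaceVotes P M Q) = y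

/-- `M` is a coalition of possible manipulators: it is one against some candidate. -/
def IsCoalition {V C : Type*} {m : ℕ} (r : VotingRule V C m) (P : Profile V C m)
    (M : Finset V) : Prop :=
  ∃ y, IsCoalitionAgainst r P M y

/-- The coalition's votes in the test: in the reported vote of each member, `x` is moved to the
first and `y` to the second position, the order of the other candidates being kept. -/
def testVotes {V C : Type*} {m : ℕ} (P : Profile V C m) (M : Finset V) (x y : C) :
    Profile {v // v ∈ M} C m :=
  fun j => ((P j).moveToTop y).moveToTop x

/-! ### Polynomial time -/

open Classical in
/-- The decision problem `p` is in P, for inputs written as strings by `enc`: a Turing machine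
decides it within a number of steps that is polynomial in the length of the input. -/
def InP {A Γ : Type} (enc : A → List Γ) (p : A → Prop) : Prop :=
  Nonempty (Turing.TM2ComputableInPolyTime enc Computability.encodeBool fun a => decide (p a))

/-! ### The two decision problems -/

/-- An input of the problem CPM: a scoring rule (a scoring vector with rational entries and a
tie-breaking order), a profile of `n` voters over `m` candidates, and a set `M` of voters. -/
structure CPMInput where
  m : ℕ
  n : ℕ
  scores : Fin m → ℚ
  tie : Preference (Fin m) m
  profile : Profile (Fin n) (Fin m) m
  M : Finset (Fin n)
  isScoringVector : IsScoringVector fun i => (scores i : ℝ)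

/-- An input of the problem CPMW: in addition, a candidate `y`. -/
structure CPMWInput extends CPMInput where
  y : Fin m

namespace CPMInput

/-- The scoring vector of an input. -/
def vector (I : CPMInput) : Fin I.m → ℝ := fun i => (I.scores i : ℝ)

/-- The voting rule of an input. -/
noncomputable def rule (I : CPMInput) : VotingRule (Fin I.n) (Fin I.m) I.m :=
  haveI : Nonempty (Fin I.m) := ⟨⟨0, Nat.lt_of_lt_of_le Nat.two_pos I.isScoringVector.two_le⟩⟩
  scoringRule I.vector I.tie

end CPMInput

/-- The problem CPM. -/
def CPM (I : CPMInput) : Prop := IsCoalition I.rule I.profile I.M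

/-- The problem CPMW. -/
def CPMW (I : CPMWInput) : Prop := IsCoalitionAgainst I.rule I.profile I.M I.y

/-! ### Inputs as strings -/

namespace Encode

open Computability

/-- A natural number in binary, followed by a comma. -/
def nat (k : ℕ) : List Γ' := (encodeNat k).map Γ'.bit ++ [Γ'.comma]

/-- An integer: a sign bit (`true` if it is negative) and the absolute value in binary. -/
def int (z : ℤ) : List Γ' := Γ'.bit (decide (z < 0)) :: nat z.natAbs

/-- The least common denominator of a rational vector. -/
def commonDen {m : ℕ} (q : Fin m → ℚ) : ℕ := Finset.univ.lcm fun i => (q i).den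

/-- A rational vector, brought to its least common denominator: the denominator, then the
(integral) numerators. The length is polynomially related to that of the entries written one by
one as reduced fractions. -/
def ratVector {m : ℕ} (q : Fin m → ℚ) : List Γ' :=
  nat (commonDen q) ++ (List.finRange m).flatMap (fun i => int (q i * commonDen q).num) ++ [Γ'.ket]

/-- A preference: the candidates from the most to the least preferred one. -/
def preference {m : ℕ} (p : Preference (Fin m) m) : List Γ' :=
  (List.finRange m).flatMap (fun i => nat (p.symm i : ℕ)) ++ [Γ'.ket]

/-- An input of CPM: the scoring vector, the tie-breaking order, and for each voter a bit that
tells whether the voter belongs to `M`, with the vote. -/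
def cpm (I : CPMInput) : List Γ' :=
  ratVector I.scores ++ preference I.tie ++
    (List.finRange I.n).flatMap fun v => Γ'.bit (decide (v ∈ I.M)) :: preference (I.profile v)

/-- An input of CPMW: the candidate `y`, then the rest as for CPM. -/
def cpmw (I : CPMWInput) : List Γ' := nat (I.y : ℕ) ++ cpm I.toCPMInput

end Encode

/-! Part (1) compares arbitrary successful votes `Q` of the coalition with the test votes. In each
vote of `Q` the candidate `x` precedes `y`, so it leads `y` by some `α i - α j` with `i < j`. By
monotonicity and the gap condition (`FirstGapMinimal.le_sub`) this is at least the first gap, which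
is exactly the lead of `x` over `y` in a test vote. Hence `x` is at most as far ahead of `y` in the
test as under `Q`, that is, not ahead at all. Compared with the original profile, `x` loses no
points in the test, and every third candidate `c` gains none (`Preference.le_moveToTop`). So the
score of `c` is bounded in turn by the original scores of `c` and `x` and by the test scores of `x`
and `y`. A tie of `c` with `y` makes this a chain of equalities, and then the tie-breaking for `y`
over `x` under `Q` and for `x` over `c` in the original profile combine. This is
`isCoalitionAgainst_iff`; its converse holds because the test votes are admissible themselves.

For part (2), the test amounts to two winner determinations, and CPM repeats it for every candidate.
Clearing the common denominator makes the scores integers without changing any comparison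
(`winner_ballots`), and a total is kept as a difference of two binary numbers.

Membership in P is proved for actual Turing machines. Structured programs compile to stack machines
(`Exec.run`), data are binary trees in prefix code, and `PolyTime` is closed under composition,
pairing, case distinction and folds. The essential restriction on a fold is that each step enlarges
the accumulator by an amount bounded independently of the accumulator (`PolyTime.foldl`). Binary
addition meets it, since lengths only add up. `inP_of_polyTime` supplies input and output, and
`decideCPM_iff` and `decideCPMW_iff` show that parsing the input followed by the test gives the
right answer.

For part (3), all gaps of the Borda vector equal one. -/

/-! ### A structured programming language for stack machines -/

namespace StackLang

open Turing TM2

/-- Structured programs for machines with stacks indexed by `K` and a register of type `σ`. -/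
inductive Prog {K : Type} (Γ : K → Type) (σ : Type)
  | push (k : K) (f : σ → Γ k)
  | pop (k : K) (f : σ → Option (Γ k) → σ)
  | seq (p q : Prog Γ σ)
  | ite (c : σ → Bool) (p q : Prog Γ σ)
  | loop (c : σ → Bool) (p : Prog Γ σ)

namespace Prog

variable {K : Type} {Γ : K → Type} {σ : Type}

/-- The labels of the stack machine code of a program. -/
def Label : Prog Γ σ → Type
  | push _ _ => Unit
  | pop _ _ => Unit
  | seq p q => p.Label ⊕ q.Label
  | ite _ p q => Option (p.Label ⊕ q.Label)
  | loop _ p => Option p.Label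

/-- The label at which a program starts. -/
def entry : (p : Prog Γ σ) → p.Label
  | push _ _ => ()
  | pop _ _ => ()
  | seq p _ => Sum.inl p.entry
  | ite _ _ _ => none
  | loop _ _ => none

theorem finite_label : (p : Prog Γ σ) → Finite p.Label
  | push _ _ => inferInstanceAs (Finite Unit)
  | pop _ _ => inferInstanceAs (Finite Unit)
  | seq p q =>
    haveI := p.finite_label
    haveI := q.finite_label
    inferInstanceAs (Finite (p.Label ⊕ q.Label))
  | ite _ p q =>
    haveI := p.finite_label
    haveI := q.finite_label
    inferInstanceAs (Finite (Option (p.Label ⊕ q.Label)))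
  | loop _ p =>
    haveI := p.finite_label
    inferInstanceAs (Finite (Option p.Label))

/-- The stack machine code of a program, placed at the labels `emb` and left to the label `ex`. -/
def code {L : Type} : (p : Prog Γ σ) → (p.Label → L) → L → p.Label → Stmt Γ L σ
  | push k f, _, ex => fun _ => .push k f (.goto fun _ => ex)
  | pop k f, _, ex => fun _ => .pop k f (.goto fun _ => ex)
  | seq p q, emb, ex => fun l => match l with
    | Sum.inl l => p.code (fun l => emb (Sum.inl l)) (emb (Sum.inr q.entry)) l
    | Sum.inr l => q.code (fun l => emb (Sum.inr l)) ex l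
  | ite c p q, emb, ex => fun l => match l with
    | none => .branch c (.goto fun _ => emb (some (Sum.inl p.entry)))
        (.goto fun _ => emb (some (Sum.inr q.entry)))
    | some (Sum.inl l) => p.code (fun l => emb (some (Sum.inl l))) ex l
    | some (Sum.inr l) => q.code (fun l => emb (some (Sum.inr l))) ex l
  | loop c p, emb, ex => fun l => match l with
    | none => .branch c (.goto fun _ => emb (some p.entry)) (.goto fun _ => ex)
    | some l => p.code (fun l => emb (some l)) (emb none) l

variable [DecidableEq K]

/-- `Exec p v S v' S' t`: started with register `v` and stacks `S`, the program `p` ends after `t`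
steps with register `v'` and stacks `S'`. -/
inductive Exec : Prog Γ σ → σ → (∀ k, List (Γ k)) → σ → (∀ k, List (Γ k)) → ℕ → Prop
  | push (k f v S) : Exec (push k f) v S v (Function.update S k (f v :: S k)) 1
  | pop (k f v S) : Exec (pop k f) v S (f v (S k).head?) (Function.update S k (S k).tail) 1
  | seq {p q v S v' S' v'' S'' t t'} : Exec p v S v' S' t → Exec q v' S' v'' S'' t' →
      Exec (seq p q) v S v'' S'' (t + t')
  | ite_true {c p q v S v' S' t} : c v = true → Exec p v S v' S' t →
      Exec (ite c p q) v S v' S' (1 + t)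
  | ite_false {c p q v S v' S' t} : c v = false → Exec q v S v' S' t →
      Exec (ite c p q) v S v' S' (1 + t)
  | loop_false {c p v S} : c v = false → Exec (loop c p) v S v S 1
  | loop_true {c p v S v' S' v'' S'' t t'} : c v = true → Exec p v S v' S' t →
      Exec (loop c p) v' S' v'' S'' t' → Exec (loop c p) v S v'' S'' (1 + t + t')

theorem iterate_bind_add {A : Type} {f : A → Option A} {a b : A} {s t : ℕ} {c : Option A}
    (h : (flip bind f)^[s] (some a) = some b) (hc : (flip bind f)^[t] (some b) = c) :
    (flip bind f)^[s + t] (some a) = c := by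
  rw [add_comm, Function.iterate_add_apply, h, hc]

/-- The code of a program, as part of a machine `M`, behaves as the program. -/
theorem Exec.run {L : Type} {M : L → Stmt Γ L σ} {p : Prog Γ σ} {v v' : σ}
    {S S' : ∀ k, List (Γ k)} {t : ℕ} (h : Exec p v S v' S' t) :
    ∀ (emb : p.Label → L) (ex : L), (∀ l, M (emb l) = p.code emb ex l) →
      (flip bind (TM2.step M))^[t] (some ⟨some (emb p.entry), v, S⟩) = some ⟨some ex, v', S'⟩ := by
  induction h with
  | push k f v S =>
    intro emb ex hM
    simp [flip, hM, code]
  | pop k f v S =>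
    intro emb ex hM
    simp [flip, hM, code]
  | seq _ _ ih₁ ih₂ =>
    intro emb ex hM
    exact iterate_bind_add (ih₁ (fun l => emb (Sum.inl l)) _ fun l => hM (Sum.inl l))
      (ih₂ (fun l => emb (Sum.inr l)) _ fun l => hM (Sum.inr l))
  | ite_true hc _ ih =>
    intro emb ex hM
    refine iterate_bind_add ?_ (ih (fun l => emb (some (Sum.inl l))) _
      fun l => hM (some (Sum.inl l)))
    have := hM none
    simp only [entry, code] at this ⊢
    simp [flip, this, hc]
  | ite_false hc _ ih =>
    intro emb ex hM
    refine iterate_bind_add ?_ (ih (fun l => emb (some (Sum.inr l))) _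
      fun l => hM (some (Sum.inr l)))
    have := hM none
    simp only [entry, code] at this ⊢
    simp [flip, this, hc]
  | loop_false hc =>
    intro emb ex hM
    have := hM none
    simp only [entry, code] at this ⊢
    simp [flip, this, hc]
  | loop_true hc _ _ ih₁ ih₂ =>
    intro emb ex hM
    -- The body exits to `emb none`, the test of the loop itself, so the remaining rounds are the
    -- second induction hypothesis with the same placement.
    refine iterate_bind_add (iterate_bind_add ?_ (ih₁ (fun l => emb (some l)) _
      fun l => hM (some l))) (ih₂ emb ex hM)
    have := hM none
    simp only [entry, code] at this ⊢
    simp [flip, this, hc]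

end Prog

end StackLang

/-! ### Binary trees on a stack -/

namespace StackLang

open Turing Computability

/-- Binary trees, the data of the programs below. -/
inductive Datum
  | leaf
  | node (l r : Datum)

/-- The prefix code of a tree. -/
def Datum.code : Datum → List Γ'
  | leaf => [Γ'.ket]
  | node l r => Γ'.bra :: (l.code ++ r.code)

/-- The stacks besides the output stack: `main` holds the codes of a sequence of trees. -/
inductive Stk
  | input
  | main
  | aux
  | spare
  | depth
  deriving DecidableEq

instance : Fintype Stk :=
  ⟨{.input, .main, .aux, .spare, .depth}, fun k => by cases k <;> decide⟩

/-- The alphabets of the stacks; the output stack has index `none`. -/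
abbrev Sym : Option Stk → Type
  | some _ => Γ'
  | none => Bool

/-- Programs on trees. The register holds the symbol that was popped last. -/
abbrev TProg := Prog (σ := Option Γ') (Γ := Sym)

/-- The contents of all stacks. -/
abbrev Stacks := ∀ k, List (Sym k)

/-- The stacks with the given contents. -/
def stacksOf (o : List Bool) (i m a s d : List Γ') : Stacks
  | none => o
  | some .input => i
  | some .main => m
  | some .aux => a
  | some .spare => s
  | some .depth => d

section

variable {o : List Bool} {i m a s d : List Γ'}

@[simp] theorem stacksOf_output : stacksOf o i m a s d none = o := rfl
@[simp] theorem stacksOf_input : stacksOf o i m a s d (some .input) = i := rfl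
@[simp] theorem stacksOf_main : stacksOf o i m a s d (some .main) = m := rfl
@[simp] theorem stacksOf_aux : stacksOf o i m a s d (some .aux) = a := rfl
@[simp] theorem stacksOf_spare : stacksOf o i m a s d (some .spare) = s := rfl
@[simp] theorem stacksOf_depth : stacksOf o i m a s d (some .depth) = d := rfl

@[simp] theorem update_output (l : List Bool) :
    Function.update (stacksOf o i m a s d) none l = stacksOf l i m a s d := by
  funext k; rcases k with _ | _ | _ <;> rfl

@[simp] theorem update_input (l : List Γ') :
    Function.update (stacksOf o i m a s d) (some .input) l = stacksOf o l m a s d := by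
  funext k; rcases k with _ | _ | _ <;> rfl

@[simp] theorem update_main (l : List Γ') :
    Function.update (stacksOf o i m a s d) (some .main) l = stacksOf o i l a s d := by
  funext k; rcases k with _ | _ | _ <;> rfl

@[simp] theorem update_aux (l : List Γ') :
    Function.update (stacksOf o i m a s d) (some .aux) l = stacksOf o i m l s d := by
  funext k; rcases k with _ | _ | _ <;> rfl

@[simp] theorem update_spare (l : List Γ') :
    Function.update (stacksOf o i m a s d) (some .spare) l = stacksOf o i m a l d := by
  funext k; rcases k with _ | _ | _ <;> rfl

@[simp] theorem update_depth (l : List Γ') :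
    Function.update (stacksOf o i m a s d) (some .depth) l = stacksOf o i m a s l := by
  funext k; rcases k with _ | _ | _ <;> rfl

end

/-- From any register, `p` leads from the stacks `S` to the stacks `S'` in at most `t` steps. -/
def Runs (p : TProg) (S S' : Stacks) (t : ℕ) : Prop :=
  ∀ v, ∃ v' t', t' ≤ t ∧ p.Exec v S v' S' t'

theorem Runs.mono {p : TProg} {S S' : Stacks} {t u : ℕ} (h : Runs p S S' t) (htu : t ≤ u) :
    Runs p S S' u := fun v =>
  let ⟨v', t', ht, he⟩ := h v
  ⟨v', t', ht.trans htu, he⟩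

theorem Runs.seq {p q : TProg} {S S' S'' : Stacks} {t u : ℕ} (h : Runs p S S' t)
    (h' : Runs q S' S'' u) : Runs (p.seq q) S S'' (t + u) := fun v =>
  let ⟨v', _, ht, he⟩ := h v
  let ⟨v'', _, hu, hq⟩ := h' v'
  ⟨v'', _, add_le_add ht hu, he.seq hq⟩

/-- Pop a symbol into the register. -/
def popSym (k : Stk) : TProg := .pop (some k) fun _ s => s

/-- Push the symbol `s`. -/
def pushSym (k : Stk) (s : Γ') : TProg := .push (some k) fun _ => s

/-- Push the symbol in the register. -/
def pushReg (k : Stk) : TProg := .push (some k) fun v => v.getD Γ'.blank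

theorem popSym_exec (k : Stk) (v : Option Γ') (S : Stacks) :
    (popSym k).Exec v S (S (some k)).head? (Function.update S (some k) (S (some k)).tail) 1 :=
  .pop _ _ _ _

theorem pushSym_exec (k : Stk) (s : Γ') (v : Option Γ') (S : Stacks) :
    (pushSym k s).Exec v S v (Function.update S (some k) (s :: S (some k))) 1 :=
  .push _ _ _ _

theorem pushReg_exec (k : Stk) (s : Γ') (S : Stacks) :
    (pushReg k).Exec (some s) S (some s) (Function.update S (some k) (s :: S (some k))) 1 :=
  .push _ _ _ _

theorem pushSym_runs (s : Γ') (o : List Bool) (i m a r d : List Γ') :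
    Runs (pushSym .main s) (stacksOf o i m a r d) (stacksOf o i (s :: m) a r d) 1 := fun v =>
  ⟨v, 1, le_rfl, by simpa using pushSym_exec .main s v (stacksOf o i m a r d)⟩

/-- The test whether the register holds a symbol. -/
def regSome (v : Option Γ') : Bool := v.isSome

/-- The test whether the register holds an opening bracket. -/
def regBra (v : Option Γ') : Bool := some Γ'.bra == v

/-- Move all symbols from the stack `k` by means of `p`, which pushes the register. -/
def emptyStack (k : Stk) (p : TProg) : TProg :=
  .seq (popSym k) (.loop regSome (.seq p (popSym k)))

/-- `F l r` stands for the stacks when `l` is still to be moved and `r` has been collected, so that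
one proof serves all transfers. A symbol costs `c` steps for `p`, one for the test and one for the
pop. -/
theorem emptyStack_runs {k : Stk} {p : TProg} {c : ℕ} (F : List Γ' → List Γ' → Stacks)
    (hF : ∀ l r, F l r (some k) = l)
    (hF' : ∀ l r l', Function.update (F l r) (some k) l' = F l' r)
    (hp : ∀ s l r, ∃ t ≤ c, p.Exec (some s) (F l r) (some s) (F l (s :: r)) t)
    (l r : List Γ') :
    Runs (emptyStack k p) (F l r) (F [] (l.reverse ++ r)) (2 + (c + 2) * l.length) := by
  have key : ∀ l r : List Γ', ∃ v' t', t' ≤ 1 + (c + 2) * l.length ∧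
      (Prog.loop regSome (.seq p (popSym k))).Exec l.head? (F l.tail r) v'
        (F [] (l.reverse ++ r)) t' := by
    intro l
    induction l with
    | nil => exact fun r => ⟨_, 1, by simp, .loop_false rfl⟩
    | cons s l ih =>
      intro r
      obtain ⟨t, ht, he⟩ := hp s l r
      obtain ⟨v', t', ht', he'⟩ := ih (s :: r)
      refine ⟨v', 1 + (t + 1) + t', ?_, ?_⟩
      · simp only [List.length_cons]; linarith
      · have h2 := popSym_exec k (some s) (F l (s :: r))
        rw [hF, hF'] at h2
        have := Prog.Exec.loop_true (c := regSome) rfl (he.seq h2) he'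
        simpa using this
  intro v
  obtain ⟨v', t', ht', hr⟩ := key l r
  have h2 := popSym_exec k v (F l r)
  rw [hF, hF'] at h2
  exact ⟨v', 1 + t', by omega, h2.seq hr⟩

/-- Move trees from the main stack to the auxiliary stack as long as the register holds a symbol.
The depth stack counts the trees that remain to be moved after the current one. -/
def moveTrees : TProg :=
  .loop regSome (.seq (popSym .main) (.seq (pushReg .aux) (.ite regBra
    (.seq (pushSym .depth .blank) (.seq (pushSym .depth .blank) (popSym .depth)))
    (popSym .depth))))

/-- Move the tree on top of the main stack to the auxiliary stack, reversing its code. -/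
def moveTree : TProg := .seq (pushSym .depth .blank) (.seq (popSym .depth) moveTrees)

/-- The loop does not stop after a subtree but goes on with its sibling. Therefore the statement
prepends the moving of `x` to a given run of the rest, and the induction works from the end
backwards. The factor 7 is the cost of a round at an inner node. -/
theorem moveTrees_exec (x : Datum) : ∀ {o i m a s d v' S'' t'} (u : Γ'),
    moveTrees.Exec d.head? (stacksOf o i m (x.code.reverse ++ a) s d.tail) v' S'' t' →
    ∃ t ≤ 7 * x.code.length + t',
      moveTrees.Exec (some u) (stacksOf o i (x.code ++ m) a s d) v' S'' t := by
  induction x with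
  | leaf =>
    intro o i m a s d v' S'' t' u h
    have h1 := popSym_exec .main (some u) (stacksOf o i (Γ'.ket :: m) a s d)
    have h2 := pushReg_exec .aux Γ'.ket (stacksOf o i m a s d)
    have h3 := popSym_exec .depth (some Γ'.ket) (stacksOf o i m (Γ'.ket :: a) s d)
    simp only [stacksOf_main, stacksOf_aux, stacksOf_depth, update_main, update_aux, update_depth,
      List.head?_cons, List.tail_cons] at h1 h2 h3
    exact ⟨_, by simp [Datum.code],
      .loop_true rfl (h1.seq (h2.seq (.ite_false rfl h3))) h⟩
  | node l r ihl ihr =>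
    intro o i m a s d v' S'' t' u h
    have h1 := popSym_exec .main (some u) (stacksOf o i (Γ'.bra :: (l.code ++ (r.code ++ m))) a s d)
    have h2 := pushReg_exec .aux Γ'.bra (stacksOf o i (l.code ++ (r.code ++ m)) a s d)
    have h3 := pushSym_exec .depth .blank (some Γ'.bra)
      (stacksOf o i (l.code ++ (r.code ++ m)) (Γ'.bra :: a) s d)
    have h4 := pushSym_exec .depth .blank (some Γ'.bra)
      (stacksOf o i (l.code ++ (r.code ++ m)) (Γ'.bra :: a) s (.blank :: d))
    have h5 := popSym_exec .depth (some Γ'.bra)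
      (stacksOf o i (l.code ++ (r.code ++ m)) (Γ'.bra :: a) s (.blank :: .blank :: d))
    simp only [stacksOf_main, stacksOf_aux, stacksOf_depth, update_main, update_aux, update_depth,
      List.head?_cons, List.tail_cons] at h1 h2 h3 h4 h5
    simp only [Datum.code, List.reverse_cons, List.reverse_append, List.append_assoc,
      List.singleton_append] at h
    -- Of the two blanks pushed at a node, one returns to the register and keeps the loop alive; the
    -- other waits on the depth stack for the right subtree.
    obtain ⟨t₁, ht₁, e₁⟩ := ihr (a := l.code.reverse ++ Γ'.bra :: a) (d := d) .blank h
    obtain ⟨t₂, ht₂, e₂⟩ := ihl (a := Γ'.bra :: a) (d := .blank :: d) .blank e₁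
    have h6 := Prog.Exec.loop_true (c := regSome) rfl
      (h1.seq (h2.seq (.ite_true rfl (h3.seq (h4.seq h5))))) e₂
    refine ⟨_, ?_, by
      simpa only [moveTrees, Datum.code, List.cons_append, List.append_assoc] using h6⟩
    simp only [Datum.code, List.length_cons, List.length_append]
    omega

theorem moveTree_runs (x : Datum) (o : List Bool) (i m a s : List Γ') :
    Runs moveTree (stacksOf o i (x.code ++ m) a s []) (stacksOf o i m (x.code.reverse ++ a) s [])
      (7 * x.code.length + 3) := by
  intro v
  -- Pushing and popping a blank fills the register, so that the loop is entered; the empty depth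
  -- stack ends it after exactly one tree.
  have h1 := pushSym_exec .depth .blank v (stacksOf o i (x.code ++ m) a s [])
  have h2 := popSym_exec .depth v (stacksOf o i (x.code ++ m) a s [.blank])
  simp only [stacksOf_depth, update_depth, List.head?_cons, List.tail_cons] at h1 h2
  obtain ⟨t, ht, e⟩ := moveTrees_exec x (o := o) (i := i) (m := m) (a := a) (s := s) (d := [])
    .blank (.loop_false rfl)
  exact ⟨_, _, by omega, h1.seq (h2.seq e)⟩

theorem empty_aux_to_spare (o : List Bool) (i m a s d : List Γ') :
    Runs (emptyStack .aux (pushReg .spare)) (stacksOf o i m a s d)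
      (stacksOf o i m [] (a.reverse ++ s) d) (2 + 3 * a.length) :=
  emptyStack_runs (fun l r => stacksOf o i m l r d) (fun _ _ => rfl) (fun _ _ _ => by simp)
    (fun u l r => ⟨1, le_rfl, by simpa using pushReg_exec .spare u (stacksOf o i m l r d)⟩) a s

theorem empty_spare_to_aux (o : List Bool) (i m a s d : List Γ') :
    Runs (emptyStack .spare (pushReg .aux)) (stacksOf o i m a s d)
      (stacksOf o i m (s.reverse ++ a) [] d) (2 + 3 * s.length) :=
  emptyStack_runs (fun l r => stacksOf o i m r l d) (fun _ _ => rfl) (fun _ _ _ => by simp)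
    (fun u l r => ⟨1, le_rfl, by simpa using pushReg_exec .aux u (stacksOf o i m r l d)⟩) s a

theorem empty_aux_to_main (o : List Bool) (i m a s d : List Γ') :
    Runs (emptyStack .aux (pushReg .main)) (stacksOf o i m a s d)
      (stacksOf o i (a.reverse ++ m) [] s d) (2 + 3 * a.length) :=
  emptyStack_runs (fun l r => stacksOf o i r l s d) (fun _ _ => rfl) (fun _ _ _ => by simp)
    (fun u l r => ⟨1, le_rfl, by simpa using pushReg_exec .main u (stacksOf o i r l s d)⟩) a m

/-- Clear the auxiliary stack. -/
def clearAux : TProg :=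
  .seq (popSym .aux) (.loop regSome (popSym .aux))

theorem clearAux_runs (o : List Bool) (i m a s d : List Γ') :
    Runs clearAux (stacksOf o i m a s d) (stacksOf o i m [] s d) (2 + 2 * a.length) := by
  have key : ∀ a : List Γ', ∃ v' t', t' ≤ 1 + 2 * a.length ∧
      (Prog.loop regSome (popSym .aux)).Exec a.head? (stacksOf o i m a.tail s d) v'
        (stacksOf o i m [] s d) t' := by
    intro a
    induction a with
    | nil => exact ⟨_, 1, by simp, .loop_false rfl⟩
    | cons u a ih =>
      obtain ⟨v', t', ht', he'⟩ := ih
      have h2 := popSym_exec .aux (some u) (stacksOf o i m a s d)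
      simp only [stacksOf_aux, update_aux] at h2
      exact ⟨v', _, by simp only [List.length_cons]; omega, .loop_true rfl h2 he'⟩
  intro v
  obtain ⟨v', t', ht', hr⟩ := key a
  have h2 := popSym_exec .aux v (stacksOf o i m a s d)
  simp only [stacksOf_aux, update_aux] at h2
  exact ⟨v', 1 + t', by omega, h2.seq hr⟩

/-- The stacks between two operations on trees. -/
abbrev work (m : List Γ') : Stacks := stacksOf [] [] m [] [] []

/-- Remove the tree on top. -/
def dropTree : TProg := .seq moveTree clearAux

theorem dropTree_runs (x : Datum) (m : List Γ') :
    Runs dropTree (work (x.code ++ m)) (work m) (9 * x.code.length + 5) :=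
  ((moveTree_runs x _ _ _ _ _).seq (clearAux_runs _ _ _ _ _ _)).mono (by simp; omega)

/-- Exchange the two trees on top. -/
def swapTrees : TProg :=
  .seq moveTree (.seq (emptyStack .aux (pushReg .spare)) (.seq moveTree
    (.seq (emptyStack .spare (pushReg .aux)) (emptyStack .aux (pushReg .main)))))

/-- Every transfer reverses a code. After the fourth one the auxiliary stack holds both codes
reversed, with that of `x` on top, and emptying it onto the main stack restores both in exchanged
order. -/
theorem swapTrees_runs (x y : Datum) (m : List Γ') :
    Runs swapTrees (work (x.code ++ (y.code ++ m))) (work (y.code ++ (x.code ++ m)))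
      (16 * (x.code.length + y.code.length) + 12) := by
  have h1 := moveTree_runs x [] [] (y.code ++ m) [] []
  have h2 := empty_aux_to_spare [] [] (y.code ++ m) (x.code.reverse ++ []) [] []
  have h3 := moveTree_runs y [] [] m [] (x.code)
  have h4 := empty_spare_to_aux [] [] m y.code.reverse x.code []
  have h5 := empty_aux_to_main [] [] m (x.code.reverse ++ y.code.reverse) [] []
  simp only [List.append_nil, List.reverse_reverse, List.reverse_append, List.append_assoc]
    at h1 h2 h3 h4 h5
  refine (h1.seq (h2.seq (h3.seq (h4.seq h5)))).mono ?_
  simp only [List.length_reverse, List.length_append]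
  omega

/-- Duplicate the tree on top. -/
def dupTree : TProg :=
  .seq moveTree (.seq (emptyStack .aux (.seq (pushReg .main) (pushReg .spare)))
    (.seq (emptyStack .spare (pushReg .aux)) (emptyStack .aux (pushReg .main))))

theorem dupTree_runs (x : Datum) (m : List Γ') :
    Runs dupTree (work (x.code ++ m)) (work (x.code ++ (x.code ++ m)))
      (17 * x.code.length + 9) := by
  have h1 := moveTree_runs x [] [] m [] []
  have h2 := emptyStack_runs (p := .seq (pushReg .main) (pushReg .spare)) (c := 2)
    (fun l r => stacksOf [] [] (r ++ m) l r []) (k := .aux) (fun _ _ => rfl)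
    (fun _ _ _ => by simp)
    (fun u l r => ⟨2, le_rfl, by
      have e1 := pushReg_exec .main u (stacksOf [] [] (r ++ m) l r [])
      have e2 := pushReg_exec .spare u (stacksOf [] [] (u :: (r ++ m)) l r [])
      simp only [stacksOf_main, stacksOf_spare, update_main, update_spare] at e1 e2
      exact e1.seq e2⟩) x.code.reverse []
  have h3 := empty_spare_to_aux [] [] (x.code ++ m) [] x.code []
  have h4 := empty_aux_to_main [] [] (x.code ++ m) x.code.reverse [] []
  simp only [List.append_nil, List.reverse_reverse, List.nil_append] at h1 h2 h3 h4
  refine (h1.seq (h2.seq (h3.seq h4))).mono ?_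
  simp only [List.length_reverse]
  omega

/-- Push a fixed list of symbols. -/
def pushList : List Γ' → TProg
  | [] => .seq (pushSym .main .ket) (popSym .main)
  | s :: l => .seq (pushList l) (pushSym .main s)

theorem pushList_runs (l : List Γ') (o : List Bool) (i m a s d : List Γ') :
    Runs (pushList l) (stacksOf o i m a s d) (stacksOf o i (l ++ m) a s d) (l.length + 2) := by
  induction l with
  | nil =>
    intro v
    -- A push undone by a pop plays the role of an empty program.
    have e1 := pushSym_exec .main .ket v (stacksOf o i m a s d)
    have e2 := popSym_exec .main v (stacksOf o i (Γ'.ket :: m) a s d)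
    simp only [stacksOf_main, update_main, List.head?_cons, List.tail_cons] at e1 e2
    exact ⟨_, 2, by simp, e1.seq e2⟩
  | cons u l ih =>
    exact (ih.seq (pushSym_runs u _ _ _ _ _ _)).mono (by simp)

/-- Pop the top symbol and branch according to it. -/
def caseTop (p q : TProg) : TProg := .seq (popSym .main) (.ite regBra p q)

theorem caseTop_bra {p q : TProg} {m : List Γ'} {S' : Stacks} {t : ℕ}
    (h : Runs p (work m) S' t) : Runs (caseTop p q) (work (Γ'.bra :: m)) S' (t + 2) := by
  intro v
  have e1 := popSym_exec .main v (work (Γ'.bra :: m))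
  simp only [stacksOf_main, update_main, List.head?_cons, List.tail_cons] at e1
  obtain ⟨v', t', ht', e⟩ := h (some Γ'.bra)
  exact ⟨v', _, by omega, e1.seq (.ite_true rfl e)⟩

theorem caseTop_ket {p q : TProg} {m : List Γ'} {S' : Stacks} {t : ℕ}
    (h : Runs q (work m) S' t) : Runs (caseTop p q) (work (Γ'.ket :: m)) S' (t + 2) := by
  intro v
  have e1 := popSym_exec .main v (work (Γ'.ket :: m))
  simp only [stacksOf_main, update_main, List.head?_cons, List.tail_cons] at e1
  obtain ⟨v', t', ht', e⟩ := h (some Γ'.ket)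
  exact ⟨v', _, by omega, e1.seq (.ite_false rfl e)⟩

theorem popMain_runs (u : Γ') (m : List Γ') :
    Runs (popSym .main) (work (u :: m)) (work m) 1 := fun v =>
  ⟨_, 1, le_rfl, by simpa using popSym_exec .main v (work (u :: m))⟩

/-- Run `p` as long as the popped top symbol is an opening bracket. -/
def whileTop (p : TProg) : TProg :=
  .seq (popSym .main) (.loop regBra (.seq p (popSym .main)))

theorem whileTop_ket (p : TProg) (m : List Γ') :
    Runs (whileTop p) (work (Γ'.ket :: m)) (work m) 2 := by
  intro v
  have e1 := popSym_exec .main v (work (Γ'.ket :: m))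
  simp only [stacksOf_main, update_main, List.head?_cons, List.tail_cons] at e1
  exact ⟨_, 2, le_rfl, e1.seq (.loop_false rfl)⟩

theorem whileTop_bra {p : TProg} {m : List Γ'} {S S' : Stacks} {t u : ℕ}
    (h : Runs p (work m) S t) (h' : Runs (whileTop p) S S' u) :
    Runs (whileTop p) (work (Γ'.bra :: m)) S' (t + u + 2) := by
  intro v
  have e1 := popSym_exec .main v (work (Γ'.bra :: m))
  simp only [stacksOf_main, update_main, List.head?_cons, List.tail_cons] at e1
  obtain ⟨v₁, t₁, ht₁, e⟩ := h (some Γ'.bra)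
  obtain ⟨v₂, t₂, ht₂, e'⟩ := h' v₁
  -- The pop that closes a round is the opening pop of the remaining run, which is therefore split
  -- after its first instruction.
  unfold whileTop at e'
  cases e' with
  | seq e₂ e₃ =>
    cases e₂ with
    | pop => exact ⟨v₂, _, by omega, e1.seq (.loop_true rfl (e.seq (.pop _ _ _ _)) e₃)⟩

end StackLang

/-! ### Functions computed in polynomial time -/

namespace StackLang

open Turing Computability Polynomial

/-- A representation of the elements of a type by trees. -/
class Enc (α : Type) where
  enc : α → Datum

open Enc

/-- The truth values are represented by trees of the same size. -/
instance : Enc Bool :=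
  ⟨fun b => cond b (.node (.node .leaf .leaf) .leaf) (.node .leaf (.node .leaf .leaf))⟩

instance {α β : Type} [Enc α] [Enc β] : Enc (α × β) := ⟨fun x => .node (enc x.1) (enc x.2)⟩

/-- The representation of lists: the pairs of head and tail, ended by a leaf. -/
def encList {α : Type} [Enc α] : List α → Datum
  | [] => .leaf
  | x :: l => .node (enc x) (encList l)

instance {α : Type} [Enc α] : Enc (List α) := ⟨encList⟩

/-- The code of an element. -/
def encode {α : Type} [Enc α] (x : α) : List Γ' := (enc x).code

/-- The length of the code of an element. -/
def size {α : Type} [Enc α] (x : α) : ℕ := (encode x).length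

section

variable {α β : Type} [Enc α] [Enc β]

theorem encode_pair (x : α) (y : β) : encode (x, y) = Γ'.bra :: (encode x ++ encode y) := rfl

theorem encode_cons (x : α) (l : List α) :
    encode (x :: l) = Γ'.bra :: (encode x ++ encode l) := rfl

@[simp] theorem size_pair (x : α) (y : β) : size (x, y) = size x + size y + 1 := by
  simp [size, encode_pair]

@[simp] theorem size_nil : size ([] : List α) = 1 := rfl

@[simp] theorem size_cons (x : α) (l : List α) : size (x :: l) = size x + size l + 1 := by
  simp [size, encode_cons]

@[simp] theorem size_bool (b : Bool) : size b = 5 := by cases b <;> rfl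

theorem length_le_size (l : List α) : l.length ≤ size l := by
  induction l with
  | nil => simp
  | cons x l ih => simp only [List.length_cons, size_cons]; omega

theorem size_append (l l' : List α) : size (l ++ l') + 1 = size l + size l' := by
  induction l with
  | nil => simp; omega
  | cons x l ih => simp only [List.cons_append, size_cons]; omega

theorem size_reverse (l : List α) : size l.reverse = size l := by
  induction l with
  | nil => rfl
  | cons x l ih =>
    have := size_append l.reverse [x]
    simp only [List.reverse_cons, size_cons, size_nil] at *
    omega

end

section

variable {α β : Type} [Enc α] [Enc β]

theorem drop_runs (x : α) (m : List Γ') :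
    Runs dropTree (work (encode x ++ m)) (work m) (9 * size x + 5) := dropTree_runs (enc x) m

theorem swap_runs (x : α) (y : β) (m : List Γ') :
    Runs swapTrees (work (encode x ++ (encode y ++ m))) (work (encode y ++ (encode x ++ m)))
      (16 * (size x + size y) + 12) := swapTrees_runs (enc x) (enc y) m

theorem dup_runs (x : α) (m : List Γ') :
    Runs dupTree (work (encode x ++ m)) (work (encode x ++ (encode x ++ m)))
      (17 * size x + 9) := dupTree_runs (enc x) m

end

/-- Natural coefficients make all bounding polynomials monotone, so a bound on a size can be
inserted into a bound on a time. -/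
theorem eval_mono (q : ℕ[X]) {m n : ℕ} (h : m ≤ n) : q.eval m ≤ q.eval n := by
  induction q using Polynomial.induction_on' with
  | add p q hp hq => simpa using add_le_add hp hq
  | monomial k a => simpa using Nat.mul_le_mul_left _ (Nat.pow_le_pow_left h k)

/-- Pop a truth value from the main stack and branch according to it. -/
def caseBool (p q : TProg) : TProg :=
  .seq (popSym .main) (caseTop (.seq (popSym .main) (.seq (popSym .main) (.seq (popSym .main) p)))
    (.seq (popSym .main) (.seq (popSym .main) (.seq (popSym .main) q))))

/-- Both codes start with an opening bracket, differ in the second symbol and have three more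
symbols to discard. -/
theorem caseBool_runs {p q : TProg} {b : Bool} {m : List Γ'} {S' : Stacks} {t : ℕ}
    (h : Runs (cond b p q) (work m) S' t) :
    Runs (caseBool p q) (work (encode b ++ m)) S' (t + 6) := by
  cases b with
  | true =>
    exact ((popMain_runs _ _).seq (caseTop_bra ((popMain_runs _ _).seq ((popMain_runs _ _).seq
      ((popMain_runs _ _).seq h))))).mono (by omega)
  | false =>
    exact ((popMain_runs _ _).seq (caseTop_ket ((popMain_runs _ _).seq ((popMain_runs _ _).seq
      ((popMain_runs _ _).seq h))))).mono (by omega)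

/-- The program `p` computes `f` on the top of the main stack, in a time and with a result of a
size bounded by `q`. -/
def Computes {α β : Type} [Enc α] [Enc β] (p : TProg) (q : ℕ[X]) (f : α → β) : Prop :=
  ∀ a, size (f a) ≤ q.eval (size a) ∧
    ∀ m, Runs p (work (encode a ++ m)) (work (encode (f a) ++ m)) (q.eval (size a))

/-- A function computed by a program in polynomial time. -/
@[fun_prop]
def PolyTime {α β : Type} [Enc α] [Enc β] (f : α → β) : Prop :=
  ∃ p q, Computes p q f

/-! ### Closure properties of the functions computed in polynomial time. -/

namespace PolyTime

variable {α β γ δ : Type} [Enc α] [Enc β] [Enc γ] [Enc δ]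

theorem size_le {f : α → β} (hf : PolyTime f) : ∃ q : ℕ[X], ∀ a, size (f a) ≤ q.eval (size a) :=
  let ⟨_, q, h⟩ := hf
  ⟨q, fun a => (h a).1⟩

/-- A function that leaves the representation unchanged. -/
theorem of_encode_eq {f : α → β} (h : ∀ a, encode (f a) = encode a) : PolyTime f := by
  refine ⟨pushList [], X + 2, fun a => ⟨?_, fun m => ?_⟩⟩
  · simp [size, h]
  · rw [h]
    exact (pushList_runs [] _ _ _ _ _ _).mono (by simp)

@[fun_prop]
theorem id' : PolyTime (fun a : α => a) := of_encode_eq fun _ => rfl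

@[fun_prop]
theorem const (b : β) : PolyTime (fun _ : α => b) := by
  refine ⟨.seq dropTree (pushList (encode b)), 9 * X + 7 + C (size b), fun a => ⟨?_, fun m => ?_⟩⟩
  · simp
  · exact ((drop_runs a m).seq (pushList_runs (encode b) _ _ _ _ _ _)).mono
      (by simp [size, encode]; omega)

-- The size bound in `Computes` is what is needed here: the second program runs on `f a`, whose size
-- is polynomial in that of `a`.
@[fun_prop]
theorem comp {g : β → γ} {f : α → β} (hg : PolyTime g) (hf : PolyTime f) :
    PolyTime (fun a => g (f a)) := by
  obtain ⟨pg, qg, hg⟩ := hg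
  obtain ⟨pf, qf, hf⟩ := hf
  refine ⟨.seq pf pg, qf + qg.comp qf, fun a => ⟨?_, fun m => ?_⟩⟩
  · have := eval_mono qg (hf a).1
    simp only [eval_add, eval_comp]
    exact ((hg (f a)).1.trans this).trans (Nat.le_add_left _ _)
  · refine (((hf a).2 m).seq ((hg (f a)).2 m)).mono ?_
    simp only [eval_add, eval_comp]
    exact Nat.add_le_add_left (eval_mono qg (hf a).1) _

@[fun_prop]
theorem prodMk {f : α → β} {g : α → γ} (hf : PolyTime f) (hg : PolyTime g) :
    PolyTime (fun a => (f a, g a)) := by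
  obtain ⟨pf, qf, hf⟩ := hf
  obtain ⟨pg, qg, hg⟩ := hg
  refine ⟨.seq dupTree (.seq pf (.seq swapTrees (.seq pg (.seq swapTrees (pushSym .main .bra))))),
    33 * qf + 17 * qg + 33 * X + 34, fun a => ⟨?_, fun m => ?_⟩⟩
  · have h1 := (hf a).1
    have h2 := (hg a).1
    simp
    omega
  · have h1 := dup_runs a m
    have h2 := (hf a).2 (encode a ++ m)
    have h3 := swap_runs (f a) a m
    have h4 := (hg a).2 (encode (f a) ++ m)
    have h5 := swap_runs (g a) (f a) m
    have h6 := pushSym_runs .bra [] [] (encode (f a) ++ (encode (g a) ++ m)) [] [] []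
    rw [encode_pair, List.cons_append, List.append_assoc]
    refine (h1.seq (h2.seq (h3.seq (h4.seq (h5.seq h6))))).mono ?_
    have h1 := (hf a).1
    have h2 := (hg a).1
    simp only [eval_add, eval_mul, eval_X, eval_ofNat]
    omega

@[fun_prop]
theorem fst' : PolyTime (fun x : α × β => x.1) := by
  refine ⟨.seq (popSym .main) (.seq swapTrees dropTree), 25 * X + 18,
    fun ⟨a, b⟩ => ⟨?_, fun m => ?_⟩⟩
  · simp; omega
  · have h1 := popMain_runs .bra (encode a ++ (encode b ++ m))
    have h2 := swap_runs a b m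
    have h3 := drop_runs b (encode a ++ m)
    rw [encode_pair, List.cons_append, List.append_assoc]
    refine (h1.seq (h2.seq h3)).mono ?_
    simp only [eval_add, eval_mul, eval_X, eval_ofNat, size_pair]
    omega

@[fun_prop]
theorem snd' : PolyTime (fun x : α × β => x.2) := by
  refine ⟨.seq (popSym .main) dropTree, 10 * X + 6, fun ⟨a, b⟩ => ⟨?_, fun m => ?_⟩⟩
  · simp; omega
  · have h1 := popMain_runs .bra (encode a ++ (encode b ++ m))
    have h3 := drop_runs a (encode b ++ m)
    rw [encode_pair, List.cons_append, List.append_assoc]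
    refine (h1.seq h3).mono ?_
    simp only [eval_add, eval_mul, eval_X, eval_ofNat, size_pair]
    omega

@[fun_prop]
theorem fst {f : α → β × γ} (hf : PolyTime f) : PolyTime (fun x => (f x).1) := fst'.comp hf

@[fun_prop]
theorem snd {f : α → β × γ} (hf : PolyTime f) : PolyTime (fun x => (f x).2) := snd'.comp hf

-- A nonempty list has the same code as the pair of its head and tail.
@[fun_prop]
theorem cons {f : α → β} {g : α → List β} (hf : PolyTime f) (hg : PolyTime g) :
    PolyTime (fun a => f a :: g a) :=
  (of_encode_eq (f := fun x : β × List β => x.1 :: x.2) fun _ => rfl).comp (hf.prodMk hg)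

theorem cond {c : α → Bool} {f g : α → β} (hc : PolyTime c) (hf : PolyTime f)
    (hg : PolyTime g) : PolyTime (fun a => bif c a then f a else g a) := by
  obtain ⟨pc, qc, hc⟩ := hc
  obtain ⟨pf, qf, hf⟩ := hf
  obtain ⟨pg, qg, hg⟩ := hg
  refine ⟨.seq dupTree (.seq pc (caseBool pf pg)),
    17 * X + qc + qf + qg + 15, fun a => ⟨?_, fun m => ?_⟩⟩
  · have h1 := (hf a).1
    have h2 := (hg a).1
    simp only [eval_add]
    cases c a <;> simp only [cond_true, cond_false] <;> omega
  · have h1 := dup_runs a m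
    have h2 := (hc a).2 (encode a ++ m)
    refine (h1.seq (h2.seq (caseBool_runs (t := qf.eval (size a) + qg.eval (size a)) ?_))).mono ?_
    · dsimp only
      cases c a with
      | true => exact ((hf a).2 m).mono (by omega)
      | false => exact ((hg a).2 m).mono (by omega)
    · simp only [eval_add, eval_mul, eval_X, eval_ofNat]
      omega

/-- The first symbol of the code of a list separates the cases. In the nonempty case, pushing the
bracket back turns what is left into the code of the pair of head and tail. -/
theorem listCases {l : α → List β} {f : α → γ} {g : α × β × List β → γ} (hl : PolyTime l)
    (hf : PolyTime f) (hg : PolyTime g) :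
    PolyTime (fun a => List.casesOn (l a) (f a) fun x t => g (a, x, t) : α → γ) := by
  suffices h : PolyTime (fun y : List β × α =>
      (List.casesOn y.1 (f y.2) fun x t => g (y.2, x, t) : γ)) from h.comp (hl.prodMk id')
  obtain ⟨pf, qf, hf⟩ := hf
  obtain ⟨pg, qg, hg⟩ := hg
  refine ⟨.seq (popSym .main) (caseTop (.seq (pushSym .main .bra) (.seq swapTrees
    (.seq (pushSym .main .bra) pg))) pf), qf + qg.comp (X + 2) + 17 * X + 20,
    fun ⟨l, a⟩ => ?_⟩
  cases l with
  | nil =>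
    have h := eval_mono qf (show size a ≤ size (([] : List β), a) by simp; omega)
    refine ⟨(hf a).1.trans (by simp only [eval_add]; omega), fun m => ?_⟩
    refine ((popMain_runs .bra _).seq (caseTop_ket ((hf a).2 m))).mono ?_
    simp only [eval_add, eval_ofNat]
    omega
  | cons x t =>
    have h := eval_mono qg (show size (a, x, t) ≤ size (x :: t, a) + 2 by simp; omega)
    refine ⟨(hg _).1.trans (by simp only [eval_add, eval_comp, eval_X, eval_ofNat]; omega),
      fun m => ?_⟩
    have h1 := popMain_runs .bra (encode (x :: t) ++ (encode a ++ m))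
    have h2 := pushSym_runs .bra [] [] (encode x ++ (encode t ++ (encode a ++ m))) [] [] []
    have h3 := swap_runs (x, t) a m
    have h4 := pushSym_runs .bra [] [] (encode a ++ (encode (x, t) ++ m)) [] [] []
    have h5 := (hg (a, x, t)).2 m
    rw [encode_pair, List.cons_append, List.append_assoc] at h5
    change Runs _ _ (work (encode (g (a, x, t)) ++ m)) _
    rw [encode_pair, List.cons_append, List.append_assoc]
    have h6 := caseTop_bra (q := pf) (h2.seq (Runs.seq (by simpa [encode_pair] using h3)
      (h4.seq h5)))
    refine (h1.seq (by simpa [encode_cons] using h6)).mono ?_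
    simp only [eval_add, eval_comp, eval_mul, eval_X, eval_ofNat]
    simp only [size_cons, size_pair] at h ⊢
    omega

/-- Iteration: the first component is only used for its length. -/
theorem iterate {h : β → β} (hh : PolyTime h) (r : ℕ[X])
    (hr : ∀ (l : List α) (x : β) (i : ℕ), i ≤ l.length → size (h^[i] x) ≤ r.eval (size (l, x))) :
    PolyTime (fun y : List α × β => h^[y.1.length] y.2) := by
  obtain ⟨p, q, hp⟩ := hh
  refine ⟨.seq (popSym .main) (whileTop (.seq dropTree (.seq swapTrees (.seq p swapTrees)))),
    r + 3 + X * (q.comp r + 41 * X + 32 * r + 40), fun ⟨l, x⟩ => ⟨?_, fun m => ?_⟩⟩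
  · have := hr l x _ le_rfl
    simp only [eval_add]
    omega
  -- The bound `R` stays fixed while the list shrinks, so that every round is charged the same
  -- amount.
  have key : ∀ (R : ℕ) (l : List α) (x : β), size l ≤ R →
      (∀ i ≤ l.length, size (h^[i] x) ≤ r.eval R) →
      Runs (whileTop (.seq dropTree (.seq swapTrees (.seq p swapTrees))))
        (work (encode l ++ (encode x ++ m))) (work (encode (h^[l.length] x) ++ m))
        (2 + l.length * (q.eval (r.eval R) + 41 * R + 32 * r.eval R + 40)) := by
    intro R l
    induction l with
    | nil =>
      intro x _ _
      exact (whileTop_ket _ _).mono (by omega)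
    | cons a l ih =>
      intro x hl hx
      have ih' := ih (h x) (by simp at hl; omega) fun i hi => by
        have := hx (i + 1) (by simpa using hi)
        simpa using this
      have h1 := drop_runs a (encode l ++ (encode x ++ m))
      have h2 := swap_runs l x m
      have h3 := (hp x).2 (encode l ++ m)
      have h4 := swap_runs (h x) l m
      rw [encode_cons, List.cons_append, List.append_assoc]
      refine (whileTop_bra (h1.seq (h2.seq (h3.seq h4))) ih').mono ?_
      have e1 := hx 0 (by simp)
      have e2 := hx 1 (by simp)
      have e3 := eval_mono q e1
      simp only [Function.iterate_zero, id_eq, Function.iterate_one, size_cons,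
        List.length_cons, Nat.succ_mul] at *
      generalize l.length * _ = z
      omega
  have h1 := popMain_runs .bra (encode l ++ (encode x ++ m))
  rw [encode_pair, List.cons_append, List.append_assoc]
  refine (h1.seq (key (size (l, x)) l x (by simp; omega) (hr l x))).mono ?_
  have e : l.length ≤ size (l, x) := (length_le_size l).trans (by simp; omega)
  have := Nat.mul_le_mul_right (q.eval (r.eval (size (l, x))) + 41 * size (l, x) +
    32 * r.eval (size (l, x)) + 40) e
  simp only [eval_add, eval_comp, eval_mul, eval_X, eval_ofNat]
  omega

/-- A fold is computed in polynomial time if each step adds to the size of the accumulator at most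
a polynomial in the sizes of the parameter and the entry. -/
theorem foldl {l : α → List β} {b : α → γ} {g : α → γ → β → γ} (hl : PolyTime l)
    (hb : PolyTime b) (hg : PolyTime fun y : α × β × γ => g y.1 y.2.2 y.2.1) (q : ℕ[X])
    (hq : ∀ a c e, size (g a c e) ≤ size c + q.eval (size a + size e)) :
    PolyTime (fun a => (l a).foldl (g a) (b a)) := by
  -- The fold becomes an iteration on triples of the parameter, the remaining list and the
  -- accumulator; the map is the identity once the list is used up.
  let h : α × List β × γ → α × List β × γ := fun y =>
    List.casesOn y.2.1 y fun x t => (y.1, t, g y.1 y.2.2 x)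
  have hh : PolyTime h := by
    refine listCases (l := fun y : α × List β × γ => y.2.1) (f := fun y => y)
      (g := fun z => (z.1.1, z.2.2, g z.1.1 z.1.2.2 z.2.1)) (by fun_prop) (by fun_prop) ?_
    have := hg.comp (f := fun z : (α × List β × γ) × β × List β => (z.1.1, z.2.1, z.1.2.2))
      (by fun_prop)
    exact prodMk (by fun_prop) (prodMk (by fun_prop) this)
  have h_iter : ∀ (l : List β) (a : α) (c : γ),
      h^[l.length] (a, l, c) = (a, [], l.foldl (g a) c) := by
    intro l a
    induction l with
    | nil => intro c; rfl
    | cons x l ih => intro c; exact ih (g a c x)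
  have h_size : ∀ (i : ℕ) (a : α) (l : List β) (c : γ),
      size (h^[i] (a, l, c)) ≤ size (a, l, c) + i * q.eval (size (a, l, c)) := by
    intro i a
    -- Since `R` bounds the parameter and the list but not the accumulator, the size grows by at
    -- most `q.eval R` per step, hence linearly in the number of steps.
    suffices H : ∀ (R : ℕ) (l : List β) (c : γ), size a + size l ≤ R →
        size (h^[i] (a, l, c)) ≤ size (a, l, c) + i * q.eval R from
      fun l c => H _ l c (by simp; omega)
    intro R
    induction i with
    | zero => simp
    | succ i ih =>
      intro l c hR
      rw [Function.iterate_succ_apply]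
      cases l with
      | nil => exact (ih [] c hR).trans (Nat.add_le_add_left (Nat.mul_le_mul_right _ (by omega)) _)
      | cons x l =>
        simp only [size_cons] at hR
        refine (ih l (g a c x) (by omega)).trans ?_
        have e1 := hq a c x
        have e2 := eval_mono q (show size a + size x ≤ R by omega)
        simp only [size_pair, size_cons, Nat.succ_mul]
        omega
  have H : PolyTime (fun y : List β × (α × List β × γ) => h^[y.1.length] y.2) := by
    refine iterate hh (X + X * q) fun l ⟨a, l', c⟩ i hi => (h_size i a l' c).trans ?_
    have e1 : size (a, l', c) ≤ size (l, a, l', c) := by simp; omega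
    have e2 := eval_mono q e1
    have e3 : i ≤ size (l, a, l', c) := (hi.trans (length_le_size l)).trans (by simp; omega)
    simp only [eval_add, eval_mul, eval_X]
    exact add_le_add e1 (Nat.mul_le_mul e3 e2)
  -- One copy of the list counts the rounds, the other is consumed.
  have := (H.comp (f := fun a => (l a, (a, l a, b a))) (by fun_prop)).snd.snd
  simpa only [h_iter] using this

end PolyTime

end StackLang

/-! ### Decision problems -/

namespace StackLang

open Turing Computability Polynomial

/-- The symbols of an input as pairs of bits: `(true, b)` for the bit `b`, `(false, true)` for a
comma, `(false, false)` for an end marker. -/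
def symPair : Γ' → Bool × Bool
  | .bit b => (true, b)
  | .comma => (false, true)
  | _ => (false, false)

theorem size_bool_pair (x : Bool × Bool) : size x = 11 := by
  obtain ⟨a, b⟩ := x
  simp

/-- Push the symbol in the register as first entry of the list on top of the main stack. -/
def consReg : TProg :=
  .ite (fun v => v == some (.bit true)) (pushList (.bra :: encode (true, true)))
    (.ite (fun v => v == some (.bit false)) (pushList (.bra :: encode (true, false)))
      (.ite (fun v => v == some .comma) (pushList (.bra :: encode (false, true)))
        (pushList (.bra :: encode (false, false)))))

theorem consReg_exec (u : Γ') (i m : List Γ') : ∃ v' t, t ≤ 17 ∧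
    consReg.Exec (some u) (stacksOf [] i m [] [] []) v'
      (stacksOf [] i (.bra :: encode (symPair u) ++ m) [] [] []) t := by
  have H : ∀ x : Bool × Bool, Runs (pushList (.bra :: encode x)) (stacksOf [] i m [] [] [])
      (stacksOf [] i (.bra :: encode x ++ m) [] [] []) 14 := by
    intro x
    refine (pushList_runs _ _ _ _ _ _ _).mono ?_
    have := size_bool_pair x
    simp only [size, List.length_cons] at *
    omega
  obtain ⟨v', t, ht, e⟩ := H (symPair u) (some u)
  rcases u with _ | (_ | _) | _ | _ | _
  · exact ⟨v', _, by omega, .ite_false rfl (.ite_false rfl (.ite_false rfl e))⟩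
  · exact ⟨v', _, by omega, .ite_false rfl (.ite_true rfl e)⟩
  · exact ⟨v', _, by omega, .ite_true rfl e⟩
  · exact ⟨v', _, by omega, .ite_false rfl (.ite_false rfl (.ite_false rfl e))⟩
  · exact ⟨v', _, by omega, .ite_false rfl (.ite_false rfl (.ite_false rfl e))⟩
  · exact ⟨v', _, by omega, .ite_false rfl (.ite_false rfl (.ite_true rfl e))⟩

/-- Put the symbols of the input, in reverse order, as a list on the main stack. -/
def readInput : TProg :=
  .seq (pushSym .main .ket)
    (.seq (popSym .input) (.loop regSome (.seq consReg (popSym .input))))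

theorem readInput_runs (l : List Γ') : Runs readInput (stacksOf [] l [] [] [] [])
    (work (encode (l.map symPair).reverse)) (3 + 19 * l.length) := by
  have key : ∀ (l : List Γ') (acc : List (Bool × Bool)), ∃ v' t', t' ≤ 1 + 19 * l.length ∧
      (Prog.loop regSome (.seq consReg (popSym .input))).Exec l.head?
        (stacksOf [] l.tail (encode acc) [] [] []) v'
        (work (encode ((l.map symPair).reverse ++ acc))) t' := by
    intro l
    induction l with
    | nil => exact fun acc => ⟨_, 1, by simp, .loop_false rfl⟩
    | cons u l ih =>
      intro acc
      obtain ⟨v₁, t₁, ht₁, e₁⟩ := consReg_exec u l (encode acc)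
      have e₂ := popSym_exec .input v₁ (stacksOf [] l (encode (symPair u :: acc)) [] [] [])
      obtain ⟨v', t', ht', e'⟩ := ih (symPair u :: acc)
      simp only [stacksOf_input, update_input] at e₂
      have := Prog.Exec.loop_true (c := regSome) rfl (e₁.seq e₂) e'
      refine ⟨v', _, ?_, by simpa using this⟩
      simp only [List.length_cons]
      omega
  intro v
  obtain ⟨v', t', ht', e3⟩ := key l []
  have e1 := pushSym_exec .main .ket v (stacksOf [] l [] [] [] [])
  have e2 := popSym_exec .input v (stacksOf [] l [.ket] [] [] [])
  simp only [stacksOf_input, update_input, stacksOf_main, update_main, List.append_nil]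
    at e1 e2 e3
  exact ⟨v', _, by omega, e1.seq (e2.seq e3)⟩

/-- Move the truth value on the main stack to the output stack, and clear the register. -/
def writeOutput : TProg :=
  .seq (caseBool (.push none fun _ => true) (.push none fun _ => false)) (popSym .main)

theorem pushOutput_runs (b : Bool) (m : List Γ') :
    Runs (.push none fun _ => b) (work m) (stacksOf [b] [] m [] [] []) 1 := fun v =>
  ⟨v, 1, le_rfl, by
    have : (Prog.push (Γ := Sym) (σ := Option Γ') none fun _ => b).Exec v (work m) v _ 1 :=
      .push _ _ _ _
    simpa using this⟩

/-- The last pop, from an empty stack, resets the register to `none`, as the halting configuration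
demands. -/
theorem writeOutput_exec (b : Bool) (v : Option Γ') : ∃ t ≤ 8,
    writeOutput.Exec v (work (encode b)) none (stacksOf [b] [] [] [] [] []) t := by
  obtain ⟨v', t, ht, e⟩ := caseBool_runs (p := .push none fun _ => true)
    (q := .push none fun _ => false) (b := b) (m := [])
    (S' := stacksOf [b] [] [] [] [] []) (t := 1) (by cases b <;> exact pushOutput_runs _ []) v
  have e2 := popSym_exec .main v' (stacksOf [b] [] [] [] [] [])
  simp only [stacksOf_main, update_main, List.head?_nil, List.tail_nil] at e2
  rw [List.append_nil] at e
  exact ⟨_, by omega, e.seq e2⟩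

/-- The machine that runs a program and halts. -/
noncomputable def machine (p : TProg) : FinTM2 where
  K := Option Stk
  k₀ := some .input
  k₁ := none
  Γ := Sym
  Λ := Option p.Label
  main := some p.entry
  ΛFin := haveI := p.finite_label; Fintype.ofFinite _
  σ := Option Γ'
  initialState := none
  Γk₀Fin := inferInstanceAs (Fintype Γ')
  m l := match l with
    | none => .halt
    | some l => p.code some none l

theorem initList_machine (p : TProg) (l : List Γ') :
    initList (machine p) l = ⟨some (some p.entry), none, stacksOf [] l [] [] [] []⟩ := by
  unfold initList
  congr 1
  funext k
  rcases k with _ | _ | _ <;> rfl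

theorem haltList_machine (p : TProg) (l : List Bool) :
    haltList (machine p) l = ⟨none, none, stacksOf l [] [] [] [] []⟩ := by
  unfold haltList
  congr 1
  funext k
  rcases k with _ | _ | _ <;> rfl

theorem size_symPairs_le (l : List Γ') : size (l.map symPair) ≤ 12 * l.length + 1 := by
  induction l with
  | nil => simp
  | cons u l ih =>
    have := size_bool_pair (symPair u)
    simp only [List.map_cons, size_cons, List.length_cons] at *
    omega

/-- A problem is in P if it is decided by a function that is computed in polynomial time from the
reversed sequence of the input symbols. -/
theorem inP_of_polyTime {A : Type} {e : A → List Γ'} {P : A → Prop}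
    {F : List (Bool × Bool) → Bool} (hF : PolyTime F)
    (h : ∀ a, F ((e a).map symPair).reverse = true ↔ P a) : InP e P := by
  classical
  obtain ⟨p, q, hp⟩ := hF
  refine ⟨⟨⟨machine (.seq readInput (.seq p writeOutput)), Equiv.refl _, Equiv.refl _⟩,
    12 + 19 * X + q.comp (12 * X + 1), fun a => ?_⟩⟩
  -- The machine and its polynomial are given explicitly, but the individual runs are only known to
  -- exist.
  apply Classical.choice
  obtain ⟨v₁, t₁, ht₁, e₁⟩ := readInput_runs (e a) none
  obtain ⟨v₂, t₂, ht₂, e₂⟩ := (hp ((e a).map symPair).reverse).2 [] v₁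
  obtain ⟨t₃, ht₃, e₃⟩ := writeOutput_exec (F ((e a).map symPair).reverse) v₂
  simp only [List.append_nil] at e₂
  have run := (e₁.seq (e₂.seq e₃)).run (M := (machine (.seq readInput (.seq p writeOutput))).m)
    some none fun _ => rfl
  have hd : F ((e a).map symPair).reverse = decide (P a) := by
    rw [Bool.eq_iff_iff, h a]; simp
  rw [hd] at run
  have e1 : ∀ l : List Γ', l.map (Equiv.refl Γ').invFun = l := fun l => List.map_id l
  have e2 : ∀ l : List Bool, l.map (Equiv.refl Bool).invFun = l := fun l => List.map_id l
  -- The extra step executes the halting statement at the label `none`.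
  refine ⟨⟨⟨t₁ + (t₂ + t₃) + 1, ?_⟩, ?_⟩⟩
  · erw [e1, e2]
    rw [initList_machine]
    exact (Prog.iterate_bind_add (t := 1) run rfl).trans
      (congrArg some (haltList_machine _ _).symm)
  · have h1 := size_symPairs_le (e a)
    have h2 := size_reverse ((e a).map symPair)
    have h3 := eval_mono q (h2.trans_le h1)
    simp only [eval_add, eval_comp, eval_mul, eval_X, eval_ofNat, eval_one]
    omega

end StackLang

/-! ### Operations on lists in polynomial time -/

namespace StackLang

open Polynomial

namespace PolyTime

variable {α β γ : Type} [Enc α] [Enc β] [Enc γ]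

@[fun_prop]
theorem tail {l : α → List β} (hl : PolyTime l) : PolyTime fun a => (l a).tail := by
  suffices h : PolyTime fun l : List β => l.tail from h.comp hl
  convert! listCases (l := fun l : List β => l) (f := fun _ => []) (g := fun z => z.2.2)
    (by fun_prop) (by fun_prop) (by fun_prop) using 2 with l
  cases l <;> rfl

@[fun_prop]
theorem headD {l : α → List β} (hl : PolyTime l) (b : β) : PolyTime fun a => (l a).headD b := by
  suffices h : PolyTime fun l : List β => l.headD b from h.comp hl
  convert! listCases (l := fun l : List β => l) (f := fun _ => b) (g := fun z => z.2.1)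
    (by fun_prop) (by fun_prop) (by fun_prop) using 2 with l
  cases l <;> rfl

@[fun_prop]
theorem isEmpty {l : α → List β} (hl : PolyTime l) : PolyTime fun a => (l a).isEmpty := by
  suffices h : PolyTime fun l : List β => l.isEmpty from h.comp hl
  convert! listCases (l := fun l : List β => l) (f := fun _ => true) (g := fun _ => false)
    (by fun_prop) (by fun_prop) (by fun_prop) using 2 with l
  cases l <;> rfl

@[fun_prop]
theorem not {f : α → Bool} (hf : PolyTime f) : PolyTime fun a => !f a := by
  convert! cond hf (const false) (const true) using 2 with a

@[fun_prop]
theorem and {f g : α → Bool} (hf : PolyTime f) (hg : PolyTime g) :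
    PolyTime fun a => f a && g a := by
  convert! cond hf hg (const false) using 2 with a
  cases f a <;> rfl

@[fun_prop]
theorem or {f g : α → Bool} (hf : PolyTime f) (hg : PolyTime g) :
    PolyTime fun a => f a || g a := by
  convert! cond hf (const true) hg using 2 with a

@[fun_prop]
theorem beq_bool {f g : α → Bool} (hf : PolyTime f) (hg : PolyTime g) :
    PolyTime fun a => f a == g a := by
  convert! cond hf hg hg.not using 2 with a
  cases f a <;> cases g a <;> rfl

@[fun_prop]
theorem reverse {l : α → List β} (hl : PolyTime l) : PolyTime fun a => (l a).reverse := by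
  have := foldl (g := fun _ acc e => e :: acc) hl (const []) (by fun_prop) (X + 1)
    (by intro a c e; simp; omega)
  simpa using this

@[fun_prop]
theorem append {l l' : α → List β} (hl : PolyTime l) (hl' : PolyTime l') :
    PolyTime fun a => l a ++ l' a := by
  have := foldl (g := fun _ acc e => e :: acc) hl.reverse hl' (by fun_prop) (X + 1)
    (by intro a c e; simp; omega)
  simpa using this

theorem foldr {l : α → List β} {b : α → γ} {g : α → β → γ → γ} (hl : PolyTime l)
    (hb : PolyTime b) (hg : PolyTime fun y : α × β × γ => g y.1 y.2.1 y.2.2) (q : ℕ[X])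
    (hq : ∀ a e c, size (g a e c) ≤ size c + q.eval (size a + size e)) :
    PolyTime (fun a => (l a).foldr (g a) (b a)) := by
  have := foldl (g := fun a c e => g a e c) hl.reverse hb hg q fun a c e => hq a e c
  simpa using this

theorem map {l : α → List β} {f : α → β → γ} (hl : PolyTime l)
    (hf : PolyTime fun y : α × β => f y.1 y.2) : PolyTime fun a => (l a).map (f a) := by
  obtain ⟨q, hq⟩ := hf.size_le
  have := foldr (g := fun a e acc => f a e :: acc) hl (const [])
    ((hf.comp (f := fun y : α × β × List γ => (y.1, y.2.1)) (by fun_prop)).cons (by fun_prop))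
    (q.comp (X + 1) + 1) (by
      intro a e c
      have := hq (a, e)
      simp only [size_pair, size_cons, eval_add, eval_comp, eval_X, eval_one] at *
      omega)
  convert! this using 2 with a
  induction l a <;> simp_all

theorem filter {l : α → List β} {f : α → β → Bool} (hl : PolyTime l)
    (hf : PolyTime fun y : α × β => f y.1 y.2) : PolyTime fun a => (l a).filter (f a) := by
  have := foldr (g := fun a e acc => bif f a e then e :: acc else acc) hl (const [])
    (cond (hf.comp (f := fun y : α × β × List β => (y.1, y.2.1)) (by fun_prop)) (by fun_prop)
      (by fun_prop))
    (X + 1) (by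
      intro a e c
      cases f a e <;> simp
      omega)
  convert! this using 2 with a
  induction l a with
  | nil => rfl
  | cons x l ih => cases h : f a x <;> simp [h, ih]

theorem flatMap {l : α → List β} {f : α → β → List γ} (hl : PolyTime l)
    (hf : PolyTime fun y : α × β => f y.1 y.2) : PolyTime fun a => (l a).flatMap (f a) := by
  obtain ⟨q, hq⟩ := hf.size_le
  have := foldr (g := fun a e acc => f a e ++ acc) hl (const [])
    ((hf.comp (f := fun y : α × β × List γ => (y.1, y.2.1)) (by fun_prop)).append (by fun_prop))
    (q.comp (X + 1) + 1) (by
      intro a e c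
      have := hq (a, e)
      have h := size_append (f a e) c
      simp only [size_pair, eval_add, eval_comp, eval_X, eval_one] at *
      omega)
  convert! this using 2 with a
  induction l a <;> simp_all

theorem any {l : α → List β} {f : α → β → Bool} (hl : PolyTime l)
    (hf : PolyTime fun y : α × β => f y.1 y.2) : PolyTime fun a => (l a).any (f a) := by
  convert! (filter hl hf).isEmpty.not using 2 with a
  rw [Bool.eq_iff_iff]
  simp

-- The state of the fold over the first list consists of the rest of the second list and the pairs
-- found so far, in reverse order.
@[fun_prop]
theorem zip {l : α → List β} {l' : α → List γ} (hl : PolyTime l) (hl' : PolyTime l') :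
    PolyTime fun a => (l a).zip (l' a) := by
  have H : ∀ (l : List β) (l' : List γ) (acc : List (β × γ)),
      (l.foldl (fun (s : List γ × List (β × γ)) e =>
        (List.casesOn s.1 s fun x t => (t, (e, x) :: s.2))) (l', acc)).2 =
      (l.zip l').reverse ++ acc := by
    intro l
    induction l with
    | nil => simp
    | cons e l ih =>
      intro l' acc
      cases l' with
      | nil => simpa using ih [] acc
      | cons x t => simp [ih]
  have := (foldl (g := fun _ (s : List γ × List (β × γ)) e =>
      (List.casesOn s.1 s fun x t => (t, (e, x) :: s.2))) hl (hl'.prodMk (const []))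
    (listCases (l := fun y : α × β × List γ × List (β × γ) => y.2.2.1) (f := fun y => y.2.2)
      (g := fun z => (z.2.2, (z.1.2.1, z.2.1) :: z.1.2.2.2)) (by fun_prop) (by fun_prop)
      (by fun_prop)) (X + 1) (by
        rintro a ⟨c, c'⟩ e
        cases c <;> simp
        omega)).snd.reverse
  simpa [H] using this

/-- Equality of words. -/
@[fun_prop]
theorem decide_eq {l l' : α → List Bool} (hl : PolyTime l) (hl' : PolyTime l') :
    PolyTime fun a => decide (l a = l' a) := by
  have H : ∀ (l l' : List Bool) (b : Bool),
      (let r := l.foldl (fun (s : List Bool × Bool) e =>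
        (s.1.tail, s.2 && (!s.1.isEmpty && s.1.headD false == e))) (l', b)
       r.2 && r.1.isEmpty) = (b && decide (l = l')) := by
    intro l
    induction l with
    | nil => intro l' b; cases l' <;> simp
    | cons e l ih =>
      intro l' b
      cases l' with
      | nil => simpa using ih [] false
      | cons x t =>
        simp only [List.foldl_cons, List.tail_cons, List.isEmpty_cons, List.headD_cons, ih]
        rw [Bool.eq_iff_iff]
        simp
        tauto
  have := foldl (g := fun _ (s : List Bool × Bool) e =>
    (s.1.tail, s.2 && (!s.1.isEmpty && s.1.headD false == e))) hl (hl'.prodMk (const true))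
    (by fun_prop) 0 (by
      rintro a ⟨c, c'⟩ e
      cases c <;> simp; omega)
  simpa only [H, Bool.true_and] using this.snd.and this.fst.isEmpty

end PolyTime

/-! ### Binary numbers -/

/-- The value of a binary number, least significant bit first. -/
def bitsVal : List Bool → ℕ
  | [] => 0
  | b :: l => b.toNat + 2 * bitsVal l

theorem bitsVal_append (l l' : List Bool) :
    bitsVal (l ++ l') = bitsVal l + 2 ^ l.length * bitsVal l' := by
  induction l with
  | nil => simp [bitsVal]
  | cons b l ih =>
    simp only [List.cons_append, bitsVal, ih, List.length_cons, pow_succ]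
    ring

/-- Since an exhausted word yields the digit `false` and an empty tail, words of different lengths
are implicitly padded with leading zeros. -/
theorem bitsVal_headD_tail (l : List Bool) :
    bitsVal l = (l.headD false).toNat + 2 * bitsVal l.tail := by
  cases l <;> simp [bitsVal]

/-- One step of the addition of binary numbers. The state consists of the remaining digits, the
carry, and the digits of the sum in reverse order. -/
def addStep (s : (List Bool × List Bool) × Bool × List Bool) :
    (List Bool × List Bool) × Bool × List Bool :=
  ((s.1.1.tail, s.1.2.tail),
    (bif s.1.1.headD false then s.1.2.headD false || s.2.1 else s.1.2.headD false && s.2.1,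
      (s.1.1.headD false == (s.1.2.headD false == s.2.1)) :: s.2.2))

/-- The sum of binary numbers. -/
def addBits (a b : List Bool) : List Bool :=
  ((a ++ b ++ [false]).foldl (fun s _ => addStep s) ((a, b), (false, []))).2.2.reverse

/-- The invariant is that the digits produced, plus the remaining numbers and the carry shifted by
their count, have a constant value. The list `u` is only a clock. It must exceed both lengths, to
leave a step for the last carry, unless nothing remains to be added. -/
theorem bitsVal_addStep {A : Type} (u : List A) : ∀ (a b : List Bool) (c : Bool) (r : List Bool),
    (a.length < u.length ∧ b.length < u.length ∨ a = [] ∧ b = [] ∧ c = false) →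
    bitsVal (u.foldl (fun s _ => addStep s) ((a, b), (c, r))).2.2.reverse =
      bitsVal r.reverse + 2 ^ r.length * (bitsVal a + bitsVal b + c.toNat) := by
  induction u with
  | nil =>
    rintro a b c r (h | ⟨rfl, rfl, rfl⟩)
    · simp at h
    · simp [bitsVal]
  | cons x u ih =>
    intro a b c r h
    rw [List.foldl_cons, addStep]
    rw [ih]
    · rw [bitsVal_headD_tail a, bitsVal_headD_tail b]
      simp only [List.reverse_cons, bitsVal_append, List.length_reverse, List.length_cons, bitsVal]
      generalize a.headD false = a₀
      generalize b.headD false = b₀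
      cases a₀ <;> cases b₀ <;> cases c <;> simp <;> ring
    · rcases h with ⟨h1, h2⟩ | ⟨rfl, rfl, rfl⟩
      · simp only [List.length_cons] at h1 h2
        -- At the last tick both words are used up, and two zero digits produce no further carry.
        rcases Nat.eq_zero_or_pos u.length with h0 | h0
        · have ha : a = [] := List.length_eq_zero_iff.1 (by omega)
          have hb : b = [] := List.length_eq_zero_iff.1 (by omega)
          right
          subst ha hb
          simp
        · left
          simp only [List.length_tail]
          omega
      · right
        simp

theorem bitsVal_addBits (a b : List Bool) : bitsVal (addBits a b) = bitsVal a + bitsVal b := by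
  rw [addBits, bitsVal_addStep]
  · simp [bitsVal]
  · left
    simp
    omega

/-- Leading zeros are not trimmed, but the length grows only additively, which is what the fold in
`scoreOf` needs. -/
theorem length_addBits (a b : List Bool) : (addBits a b).length = a.length + b.length + 1 := by
  have H : ∀ (u : List Bool) (s : (List Bool × List Bool) × Bool × List Bool),
      (u.foldl (fun s _ => addStep s) s).2.2.length = u.length + s.2.2.length := by
    intro u
    induction u with
    | nil => simp
    | cons x u ih =>
      intro s
      rw [List.foldl_cons, ih]
      simp only [addStep, List.length_cons]
      omega
  rw [addBits, List.length_reverse, H]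
  simp
  omega

theorem size_bits (l : List Bool) : size l = 6 * l.length + 1 := by
  induction l with
  | nil => rfl
  | cons b l ih => simp only [size_cons, size_bool, ih, List.length_cons]; ring

/-- One step of the comparison of binary numbers. -/
def ltStep (s : (List Bool × List Bool) × Bool) : (List Bool × List Bool) × Bool :=
  ((s.1.1.tail, s.1.2.tail),
    bif s.1.1.headD false == s.1.2.headD false then s.2 else s.1.2.headD false)

/-- The comparison of binary numbers. -/
def ltBits (a b : List Bool) : Bool :=
  ((a ++ b).foldl (fun s _ => ltStep s) ((a, b), false)).2

/-- Digits are read from the least significant one, so a later difference overrides the verdict `c`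
reached so far, and equal digits keep it. -/
theorem ltStep_foldl {A : Type} (u : List A) : ∀ (a b : List Bool) (c : Bool),
    a.length ≤ u.length → b.length ≤ u.length →
    ((u.foldl (fun s _ => ltStep s) ((a, b), c)).2 = true ↔
      bitsVal a < bitsVal b ∨ bitsVal a = bitsVal b ∧ c = true) := by
  induction u with
  | nil =>
    intro a b c ha hb
    have ha : a = [] := List.length_eq_zero_iff.1 (by simpa using ha)
    have hb : b = [] := List.length_eq_zero_iff.1 (by simpa using hb)
    subst ha hb
    simp
  | cons x u ih =>
    intro a b c ha hb
    simp only [List.length_cons] at ha hb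
    rw [List.foldl_cons, ltStep, ih _ _ _ (by simp; omega) (by simp; omega),
      bitsVal_headD_tail a, bitsVal_headD_tail b]
    dsimp only
    generalize a.headD false = a₀
    generalize b.headD false = b₀
    cases a₀ <;> cases b₀ <;> simp <;> grind

theorem ltBits_iff (a b : List Bool) : ltBits a b = true ↔ bitsVal a < bitsVal b := by
  rw [ltBits, ltStep_foldl _ _ _ _ (by simp) (by simp)]
  simp

namespace PolyTime

variable {α : Type} [Enc α]

@[fun_prop]
theorem addBits {f g : α → List Bool} (hf : PolyTime f) (hg : PolyTime g) :
    PolyTime fun a => addBits (f a) (g a) := by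
  suffices h : PolyTime fun x : List Bool × List Bool => StackLang.addBits x.1 x.2 from
    h.comp (hf.prodMk hg)
  have := foldl (l := fun x : List Bool × List Bool => x.1 ++ x.2 ++ [false])
    (b := fun x => (x, (false, []))) (g := fun _ s _ => addStep s) (by fun_prop) (by fun_prop)
    (prodMk (by fun_prop) (prodMk (cond (by fun_prop) (by fun_prop) (by fun_prop))
      (by fun_prop))) 6 (by
        rintro x ⟨⟨a, b⟩, c, r⟩ e
        cases a <;> cases b <;> simp [addStep] <;> omega)
  exact this.snd.snd.reverse

@[fun_prop]
theorem ltBits {f g : α → List Bool} (hf : PolyTime f) (hg : PolyTime g) :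
    PolyTime fun a => ltBits (f a) (g a) := by
  suffices h : PolyTime fun x : List Bool × List Bool => StackLang.ltBits x.1 x.2 from
    h.comp (hf.prodMk hg)
  have := foldl (l := fun x : List Bool × List Bool => x.1 ++ x.2)
    (b := fun x => (x, false)) (g := fun _ s _ => ltStep s) (by fun_prop) (by fun_prop)
    (prodMk (by fun_prop) (cond (by fun_prop) (by fun_prop) (by fun_prop))) 0 (by
        rintro x ⟨⟨a, b⟩, c⟩ e
        cases a <;> cases b <;> simp [ltStep] <;> omega)
  exact this.snd

end PolyTime

end StackLang

/-! ### The decision procedures -/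

namespace StackLang

open Polynomial

/-- Split a sequence of symbols at the end markers. -/
def chunks (s : List (Bool × Bool)) : List (List (Bool × Bool)) :=
  s.foldr (fun e acc => bif e.1 || e.2 then (e :: acc.headD []) :: acc.tail else [] :: acc) []

/-- Split a sequence of symbols into the words that are ended by commas. -/
def words (s : List (Bool × Bool)) : List (List Bool) :=
  s.foldr (fun e acc => bif e.1 then (e.2 :: acc.headD []) :: acc.tail else [] :: acc) []

/-- The total score of the candidate `c`, as a difference of natural numbers. The list `L` holds
the candidates in all positions of all votes with the score of the position, which is given by a
sign and an absolute value. -/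
def scoreOf (L : List (List Bool × List Bool)) (c : List Bool) : List Bool × List Bool :=
  L.foldl (fun s e => bif decide (e.1 = c) then
    (bif e.2.headD false then (s.1, addBits s.2 e.2.tail) else (addBits s.1 e.2.tail, s.2))
    else s) ([], [])

/-- The comparison of scores. -/
def scoreLt (r s : List Bool × List Bool) : Bool :=
  ltBits (addBits r.1 s.2) (addBits s.1 r.2)

/-- The first candidate in the list `tie` with maximum score. -/
def winner (L : List (List Bool × List Bool)) (tie : List (List Bool)) : List Bool :=
  tie.foldl (fun b d => bif scoreLt (scoreOf L b) (scoreOf L d) then d else b) (tie.headD [])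

/-- The candidates in all positions of all votes with the scores of the positions. -/
def ballots (scores : List (List Bool)) (votes : List (List (List Bool))) :
    List (List Bool × List Bool) :=
  votes.flatMap fun p => p.zip scores

/-- The vote of a voter in the test: a member of the coalition ranks `x` first and `y` second. -/
def testVote (x y : List Bool) (v : Bool × List (List Bool)) : List (List Bool) :=
  bif v.1 then x :: y :: v.2.filter (fun w => !decide (w = y) && !decide (w = x)) else v.2

/-- The test whether the coalition is one of possible manipulators against `y`. -/
def againstTest (scores tie : List (List Bool)) (voters : List (Bool × List (List Bool)))
    (y : List Bool) : Bool :=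
  let x := winner (ballots scores (voters.map Prod.snd)) tie
  !decide (y = x) && decide (winner (ballots scores (voters.map (testVote x y))) tie = y)

/-- The flag and the vote of a voter. -/
def parseVoter (s : List (Bool × Bool)) : Bool × List (List Bool) :=
  ((s.headD (false, false)).2, words s.tail)

/-- The decision procedure for CPM. -/
def decideCPM (s : List (Bool × Bool)) : Bool :=
  (words ((chunks s).tail.headD [])).any fun y =>
    againstTest (words ((chunks s).headD [])).tail (words ((chunks s).tail.headD []))
      ((chunks s).tail.tail.map parseVoter) y

/-- The decision procedure for CPMW. -/
def decideCPMW (s : List (Bool × Bool)) : Bool :=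
  againstTest (words ((chunks s).headD [])).tail.tail (words ((chunks s).tail.headD []))
    ((chunks s).tail.tail.map parseVoter) ((words ((chunks s).headD [])).headD [])

namespace PolyTime

variable {α : Type} [Enc α]

@[fun_prop]
theorem chunks {s : α → List (Bool × Bool)} (hs : PolyTime s) :
    PolyTime fun a => chunks (s a) := by
  refine foldr (g := fun _ (e : Bool × Bool) acc =>
    bif e.1 || e.2 then (e :: acc.headD []) :: acc.tail else [] :: acc) hs (const [])
    (cond (by fun_prop) (by fun_prop) (by fun_prop)) (X + 3) ?_
  intro a e c
  cases e.1 || e.2 <;> cases c <;> simp <;> omega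

@[fun_prop]
theorem words {s : α → List (Bool × Bool)} (hs : PolyTime s) :
    PolyTime fun a => words (s a) := by
  refine foldr (g := fun _ (e : Bool × Bool) acc =>
    bif e.1 then (e.2 :: acc.headD []) :: acc.tail else [] :: acc) hs (const [])
    (cond (by fun_prop) (by fun_prop) (by fun_prop)) (X + 10) ?_
  intro a e c
  cases e.1 <;> cases c <;> simp <;> omega

theorem size_tail_le (l : List Bool) : size l.tail ≤ size l := by
  cases l <;> simp; omega

-- An entry lengthens at most one of the two totals, by at most its own length plus one, whatever
-- has been accumulated.
@[fun_prop]
theorem scoreOf {L : α → List (List Bool × List Bool)} {c : α → List Bool} (hL : PolyTime L)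
    (hc : PolyTime c) : PolyTime fun a => scoreOf (L a) (c a) := by
  suffices h : PolyTime fun x : List (List Bool × List Bool) × List Bool =>
    StackLang.scoreOf x.1 x.2 from h.comp (hL.prodMk hc)
  refine foldl (l := fun x : List (List Bool × List Bool) × List Bool => x.1)
    (b := fun _ => ([], [])) (g := fun x s e => bif decide (e.1 = x.2) then
    (bif e.2.headD false then (s.1, StackLang.addBits s.2 e.2.tail)
      else (StackLang.addBits s.1 e.2.tail, s.2)) else s) (by fun_prop) (by fun_prop)
    (cond (by fun_prop) (cond (by fun_prop) (by fun_prop) (by fun_prop)) (by fun_prop)) (X + 10) ?_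
  rintro x ⟨p, n⟩ ⟨w, v⟩
  have h1 := size_tail_le v
  have h2 := length_addBits p v.tail
  have h3 := length_addBits n v.tail
  rw [size_bits v.tail] at h1
  cases decide (w = x.2) <;> cases v.headD false <;>
    simp only [cond_true, cond_false, size_pair, size_bits, eval_add, eval_X, eval_ofNat] at * <;>
    omega

@[fun_prop]
theorem scoreLt {s t : α → List Bool × List Bool} (hs : PolyTime s) (ht : PolyTime t) :
    PolyTime fun a => scoreLt (s a) (t a) := by
  unfold StackLang.scoreLt
  fun_prop

@[fun_prop]
theorem winner {L : α → List (List Bool × List Bool)} {t : α → List (List Bool)}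
    (hL : PolyTime L) (ht : PolyTime t) : PolyTime fun a => winner (L a) (t a) := by
  refine foldl (g := fun a b d => bif StackLang.scoreLt (StackLang.scoreOf (L a) b)
    (StackLang.scoreOf (L a) d) then d else b) ht (ht.headD _)
    (cond ?_ (by fun_prop) (by fun_prop)) X ?_
  · have := hL.comp (f := fun y : α × List Bool × List Bool => y.1) (by fun_prop)
    exact scoreLt (this.scoreOf (by fun_prop)) (this.scoreOf (by fun_prop))
  · intro a c e
    cases StackLang.scoreLt (StackLang.scoreOf (L a) c) (StackLang.scoreOf (L a) e) <;> simp
    omega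

@[fun_prop]
theorem ballots {s : α → List (List Bool)} {v : α → List (List (List Bool))}
    (hs : PolyTime s) (hv : PolyTime v) : PolyTime fun a => ballots (s a) (v a) :=
  flatMap hv (zip (by fun_prop) (hs.comp (f := fun y : α × List (List Bool) => y.1) (by fun_prop)))

@[fun_prop]
theorem testVote {x y : α → List Bool} {v : α → Bool × List (List Bool)} (hx : PolyTime x)
    (hy : PolyTime y) (hv : PolyTime v) : PolyTime fun a => testVote (x a) (y a) (v a) := by
  refine cond (by fun_prop) (cons hx (cons hy (filter (f := fun a w =>
    !decide (w = y a) && !decide (w = x a)) (by fun_prop) ?_))) (by fun_prop)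
  have hx' := hx.comp (f := fun z : α × List Bool => z.1) (by fun_prop)
  have hy' := hy.comp (f := fun z : α × List Bool => z.1) (by fun_prop)
  exact (decide_eq (by fun_prop) hy').not.and (decide_eq (by fun_prop) hx').not

@[fun_prop]
theorem againstTest {s t : α → List (List Bool)} {v : α → List (Bool × List (List Bool))}
    {y : α → List Bool} (hs : PolyTime s) (ht : PolyTime t) (hv : PolyTime v)
    (hy : PolyTime y) : PolyTime fun a => againstTest (s a) (t a) (v a) (y a) := by
  have hx : PolyTime fun a =>
      StackLang.winner (StackLang.ballots (s a) ((v a).map Prod.snd)) (t a) :=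
    winner (ballots hs (map (f := fun _ => Prod.snd) hv (by fun_prop))) ht
  refine (decide_eq hy hx).not.and (decide_eq (winner (ballots hs (map hv ?_)) ht) hy)
  exact testVote (hx.comp (f := fun z : α × Bool × List (List Bool) => z.1) (by fun_prop))
    (hy.comp (f := fun z : α × Bool × List (List Bool) => z.1) (by fun_prop)) (by fun_prop)

@[fun_prop]
theorem parseVoters {s : α → List (List (Bool × Bool))} (hs : PolyTime s) :
    PolyTime fun a => (s a).map parseVoter :=
  map (f := fun _ => parseVoter) hs (prodMk (by fun_prop) (by fun_prop))

theorem decideCPMW : PolyTime decideCPMW := by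
  unfold StackLang.decideCPMW
  fun_prop

theorem decideCPM : PolyTime decideCPM := by
  unfold StackLang.decideCPM
  exact any (by fun_prop) (againstTest (by fun_prop) (by fun_prop) (by fun_prop) (by fun_prop))

end PolyTime

end StackLang

/-! ### Correctness of the test -/

section Election

variable {V C : Type*} {m : ℕ}

theorem lexTieBreak_eq_iff (t : Preference C m) (S : Finset C) (hS : S.Nonempty) (c : C) :
    lexTieBreak t S hS = c ↔ c ∈ S ∧ ∀ d ∈ S, t c ≤ t d := by
  unfold lexTieBreak
  rw [Equiv.symm_apply_eq, Finset.min'_eq_iff]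
  simp only [Finset.mem_map_equiv, Equiv.symm_apply_apply, and_congr_right_iff]
  exact fun _ => ⟨fun h d hd => h (t d) (by simpa using hd), fun h b hb => by simpa using h _ hb⟩

/-- This reduces winning to inequalities between scores; a candidate that scores at least as much as
the winner is one that ties with it. -/
theorem scoringRule_eq_iff [Fintype V] [Fintype C] [Nonempty C] (α : Fin m → ℝ)
    (t : Preference C m) (P : Profile V C m) (c : C) :
    scoringRule α t P = c ↔ (∀ d, totalScore α P d ≤ totalScore α P c) ∧
      ∀ d, totalScore α P c ≤ totalScore α P d → t c ≤ t d := by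
  rw [scoringRule, lexTieBreak_eq_iff]
  simp only [topScorers, Finset.mem_filter, Finset.mem_univ, true_and]
  exact and_congr_right fun h => ⟨fun h' d hd => h' d fun e => (h e).trans hd,
    fun h' d hd => h' d (hd c)⟩

theorem Preference.coe_moveToTop_self (p : Preference C m) (c : C) :
    (p.moveToTop c c : ℕ) = 0 := by
  rw [moveToTop, Equiv.trans_apply, Fin.coe_cycleRange_of_le le_rfl]
  simp

/-- Those ahead of `c` drop by one place and those behind keep theirs, so no other candidate gains
points. -/
theorem Preference.le_moveToTop (p : Preference C m) {c d : C} (h : d ≠ c) :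
    p d ≤ p.moveToTop c d := by
  rw [moveToTop, Equiv.trans_apply]
  rcases lt_or_gt_of_ne (p.injective.ne h) with h | h
  · rw [Fin.le_def, Fin.coe_cycleRange_of_lt h]
    omega
  · rw [Fin.cycleRange_of_gt h]

/-- When `x` is moved up from behind, `y` is at the top and is displaced by exactly one place. -/
theorem Preference.coe_moveToTop_moveToTop (p : Preference C m) {x y : C} (h : y ≠ x) :
    ((p.moveToTop y).moveToTop x y : ℕ) = 1 := by
  have h0 := p.coe_moveToTop_self y
  have hlt : p.moveToTop y y < p.moveToTop y x := by
    refine lt_of_le_of_ne ?_ ((p.moveToTop y).injective.ne h)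
    rw [Fin.le_def, h0]
    exact Nat.zero_le _
  change (Fin.cycleRange (p.moveToTop y x) (p.moveToTop y y) : ℕ) = 1
  rw [Fin.coe_cycleRange_of_lt hlt, h0]

/-- As `j` is at least `i + 1`, the difference contains the gap that follows `i`. -/
theorem FirstGapMinimal.le_sub {α : Fin m → ℝ} (hα : Antitone α) (h : FirstGapMinimal α)
    (hm : 2 ≤ m) {i j : Fin m} (hij : i < j) :
    α ⟨0, by omega⟩ - α ⟨1, by omega⟩ ≤ α i - α j := by
  have h1 := h i (by omega)
  have h2 : α j ≤ α ⟨i + 1, by omega⟩ := hα (by rw [Fin.le_def]; simpa using hij)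
  linarith

/-- A set of voters is a coalition of possible manipulators against `y` if and only if `y` wins
with the votes of the test. -/
theorem isCoalitionAgainst_iff [Fintype V] [Fintype C] [Nonempty C] {α : Fin m → ℝ}
    (t : Preference C m) (hα : IsScoringVector α) (hgap : FirstGapMinimal α)
    (P : Profile V C m) (M : Finset V) {x y : C} (hx : scoringRule α t P = x) (hyx : y ≠ x) :
    IsCoalitionAgainst (scoringRule α t) P M y ↔
      scoringRule α t (replaceVotes P M (testVotes P M x y)) = y := by
  classical
  constructor
  · rintro ⟨-, Q, hQ, hy⟩
    rw [hx] at hQ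
    rw [scoringRule_eq_iff] at hx hy ⊢
    set T := replaceVotes P M (testVotes P M x y) with hT
    -- The comparison is made vote by vote: members contribute the first gap in the test and at
    -- least as much under `Q`, the other voters the same on both sides.
    have hdiff : totalScore α T x - totalScore α T y ≤
        totalScore α (replaceVotes P M Q) x - totalScore α (replaceVotes P M Q) y := by
      simp only [totalScore, ← Finset.sum_sub_distrib]
      refine Finset.sum_le_sum fun v _ => ?_
      by_cases hv : v ∈ M
      · simp only [hT, replaceVotes, hv, dite_true, testVotes]
        have e0 : ((P v).moveToTop y).moveToTop x x = ⟨0, by have := hα.two_le; omega⟩ :=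
          Fin.ext (Preference.coe_moveToTop_self _ x)
        have e1 : ((P v).moveToTop y).moveToTop x y = ⟨1, by have := hα.two_le; omega⟩ :=
          Fin.ext (Preference.coe_moveToTop_moveToTop _ hyx)
        rw [e0, e1]
        exact hgap.le_sub hα.antitone hα.two_le (hQ ⟨v, hv⟩)
      · simp [hT, replaceVotes, hv]
    have hxT : totalScore α P x ≤ totalScore α T x := by
      refine Finset.sum_le_sum fun v _ => hα.antitone ?_
      by_cases hv : v ∈ M
      · simp only [hT, replaceVotes, hv, dite_true, testVotes]
        rw [Fin.le_def, Preference.coe_moveToTop_self]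
        exact Nat.zero_le _
      · simp [hT, replaceVotes, hv]
    have hcT : ∀ c, c ≠ x → c ≠ y → totalScore α T c ≤ totalScore α P c := by
      intro c hcx hcy
      refine Finset.sum_le_sum fun v _ => hα.antitone ?_
      by_cases hv : v ∈ M
      · simp only [hT, replaceVotes, hv, dite_true, testVotes]
        exact ((P v).le_moveToTop hcy).trans (Preference.le_moveToTop _ hcx)
      · simp [hT, replaceVotes, hv]
    have hxy := hy.1 x
    constructor
    · intro c
      by_cases hcx : c = x
      · subst hcx
        linarith
      · by_cases hcy : c = y
        · rw [hcy]
        -- The chain runs from `c` in the test through `c` and `x` in the original profile to `x`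
        -- and then `y` in the test.
        · linarith [hcT c hcx hcy, hx.1 c]
    · intro c hc
      -- If `y` is not ahead of `x` in the test, then by `hdiff` it is not ahead under `Q` either,
      -- where it wins by tie-breaking.
      have htx : totalScore α T y ≤ totalScore α T x → t y ≤ t x := fun h =>
        hy.2 x (by linarith)
      by_cases hcx : c = x
      · subst hcx
        exact htx hc
      · by_cases hcy : c = y
        · rw [hcy]
        -- A tie of `c` with `y` forces equality throughout the chain, so `c` already tied with `x`
        -- in the original profile and lost to it by tie-breaking.
        · have h1 := hcT c hcx hcy
          have h2 := hx.1 c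
          exact (htx (by linarith)).trans (hx.2 c (by linarith))
  · intro h
    refine ⟨hx ▸ hyx, testVotes P M x y, fun j => ?_, h⟩
    rw [hx, Preference.Prefers, Fin.lt_def]
    unfold testVotes
    rw [Preference.coe_moveToTop_self, Preference.coe_moveToTop_moveToTop _ hyx]
    exact Nat.one_pos

end Election

theorem isScoringVector_bordaVector {m : ℕ} (hm : 2 ≤ m) : IsScoringVector (bordaVector m) where
  two_le := hm
  antitone i j hij := by
    have : ((i : ℕ) : ℝ) ≤ (j : ℕ) := by exact_mod_cast hij
    unfold bordaVector
    linarith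
  last_lt_first := by
    have : (0 : ℝ) < ((m - 1 : ℕ) : ℝ) := by exact_mod_cast (by omega : 0 < m - 1)
    unfold bordaVector
    simpa using this

theorem firstGapMinimal_bordaVector (m : ℕ) : FirstGapMinimal (bordaVector m) := by
  intro i hi
  simp [bordaVector]

/-! ### Correctness of the decision procedures -/

namespace StackLang

open Computability

theorem bitsVal_encodeNat (k : ℕ) : bitsVal (encodeNat k) = k := by
  have H : ∀ p : PosNum, bitsVal (encodePosNum p) = (p : ℕ) := by
    intro p
    induction p with
    | one => rfl
    | bit0 p ih => simp [encodePosNum, bitsVal, ih]; omega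
    | bit1 p ih => simp [encodePosNum, bitsVal, ih]; omega
  conv_rhs => rw [← Num.to_of_nat k]
  rw [encodeNat]
  cases (k : Num) with
  | zero => rfl
  | pos p => exact H p

theorem encodeNat_injective : Function.Injective encodeNat := fun a b h => by
  rw [← bitsVal_encodeNat a, h, bitsVal_encodeNat]

/-- The signed number given by a word. -/
def signedVal (w : List Bool) : ℤ :=
  bif w.headD false then -(bitsVal w.tail : ℤ) else bitsVal w.tail

/-- The word of a signed number. -/
def signedWord (z : ℤ) : List Bool := decide (z < 0) :: encodeNat z.natAbs

theorem signedVal_signedWord (z : ℤ) : signedVal (signedWord z) = z := by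
  by_cases h : z < 0
  · simp [signedVal, signedWord, bitsVal_encodeNat, h, abs_of_neg h]
  · simp [signedVal, signedWord, bitsVal_encodeNat, h]
    omega

/-- The sum of the scores of the candidate `c`. -/
def intScore (L : List (List Bool × List Bool)) (c : List Bool) : ℤ :=
  (L.map fun e => if e.1 = c then signedVal e.2 else 0).sum

theorem scoreOf_eq (L : List (List Bool × List Bool)) (c : List Bool) :
    (bitsVal (scoreOf L c).1 : ℤ) - bitsVal (scoreOf L c).2 = intScore L c := by
  have H : ∀ (L : List (List Bool × List Bool)) (s : List Bool × List Bool),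
      let r := L.foldl (fun s e => bif decide (e.1 = c) then
        (bif e.2.headD false then (s.1, addBits s.2 e.2.tail) else (addBits s.1 e.2.tail, s.2))
        else s) s
      (bitsVal r.1 : ℤ) - bitsVal r.2 = bitsVal s.1 - bitsVal s.2 + intScore L c := by
    intro L
    induction L with
    | nil => simp [intScore]
    | cons e L ih =>
      intro s
      simp only [List.foldl_cons, ih]
      have : intScore (e :: L) c = (if e.1 = c then signedVal e.2 else 0) + intScore L c := by
        simp [intScore]
      rw [this]
      by_cases h : e.1 = c
      · cases h' : e.2.headD false <;>
          simp only [h, signedVal, h', decide_true, cond_true, cond_false, bitsVal_addBits,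
            Nat.cast_add, if_true] <;> ring
      · simp [h]
  have := H L ([], [])
  simp only [bitsVal, Nat.cast_zero, sub_self, zero_add] at this
  exact this

theorem scoreLt_iff (L : List (List Bool × List Bool)) (c d : List Bool) :
    scoreLt (scoreOf L c) (scoreOf L d) = true ↔ intScore L c < intScore L d := by
  rw [scoreLt, ltBits_iff, bitsVal_addBits, bitsVal_addBits, ← scoreOf_eq, ← scoreOf_eq]
  omega

/-- Both folds replace the current best only by a strictly better entry and so return the earliest
maximum. The fold of `winner` starts from the head and meets it a second time, without effect. -/
theorem argmax_eq_winner (L : List (List Bool × List Bool)) {tie : List (List Bool)}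
    (h : tie ≠ []) : tie.argmax (intScore L) = some (winner L tie) := by
  have H : ∀ (l : List (List Bool)) (b : List Bool),
      l.foldl (List.argAux fun b c => intScore L c < intScore L b) (some b) =
        some (l.foldl (fun b d => bif scoreLt (scoreOf L b) (scoreOf L d) then d else b) b) := by
    intro l
    induction l with
    | nil => simp
    | cons d l ih =>
      intro b
      simp only [List.foldl_cons]
      rw [← ih]
      congr 1
      have := scoreLt_iff L b d
      by_cases h : intScore L b < intScore L d
      · simp [List.argAux, h, this.2 h]
      · simp [List.argAux, h, Bool.eq_false_iff.2 fun h' => h (this.1 h')]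
  obtain ⟨b, l, rfl⟩ := List.exists_cons_of_ne_nil h
  have := H (b :: l) b
  rw [winner, List.headD_cons, ← this, List.argmax]
  simp [List.argAux]

/-! ### Votes as lists of words, and the winner computed from them. -/

section Votes

variable {m n : ℕ}

/-- The candidates from the most to the least preferred one. -/
def voteList (p : Preference (Fin m) m) : List (List Bool) :=
  (List.finRange m).map fun i => encodeNat (p.symm i : ℕ)

theorem encodeNat_fin_inj {a b : Fin m} :
    encodeNat (a : ℕ) = encodeNat (b : ℕ) ↔ a = b :=
  encodeNat_injective.eq_iff.trans Fin.val_inj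

theorem mem_voteList (p : Preference (Fin m) m) {w : List Bool} :
    w ∈ voteList p ↔ ∃ c : Fin m, encodeNat (c : ℕ) = w := by
  simp only [voteList, List.mem_map, List.mem_finRange, true_and]
  exact ⟨fun ⟨i, h⟩ => ⟨_, h⟩, fun ⟨c, h⟩ => ⟨p c, by simpa using h⟩⟩

/-- The earliest position in the list is thus the most preferred one in the tie-breaking order. The
`BEq` instance is left open to fit the one that occurs in `winner_ballots`. -/
theorem idxOf_voteList [BEq (List Bool)] [LawfulBEq (List Bool)]
    (p : Preference (Fin m) m) (c : Fin m) :
    (voteList p).idxOf (encodeNat (c : ℕ)) = p c := by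
  have hnd : (voteList p).Nodup := (List.nodup_finRange m).map fun i j h => by
    simpa using encodeNat_fin_inj.1 h
  have := hnd.idxOf_getElem (p c) (by simp [voteList])
  simpa [voteList] using this

/-- Behind the entry `k`, both lists are strictly increasing and contain exactly the indices other
than `k`, so they agree. -/
theorem map_cycleRange_symm (k : Fin m) :
    (List.finRange m).map k.cycleRange.symm = k :: (List.finRange m).filter (· ≠ k) := by
  obtain _ | m := m
  · exact k.elim0
  conv_lhs => rw [List.finRange_succ]
  rw [List.map_cons, Fin.cycleRange_symm_zero, List.map_map]
  congr 1
  have : (k.cycleRange.symm ∘ Fin.succ) = k.succAbove :=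
    funext fun j => Fin.cycleRange_symm_succ k j
  rw [this]
  have h1 : ((List.finRange m).map k.succAbove).Pairwise (· < ·) :=
    List.pairwise_map.2 ((List.sortedLT_finRange m).pairwise.imp
      fun h => Fin.strictMono_succAbove k h)
  have h2 : ((List.finRange (m + 1)).filter (· ≠ k)).Pairwise (· < ·) :=
    (List.sortedLT_finRange (m + 1)).pairwise.filter _
  refine List.Perm.eq_of_pairwise (fun a b _ _ h h' => absurd h' h.asymm) h1 h2 ?_
  refine (List.perm_ext_iff_of_nodup (h1.imp ne_of_lt) (h2.imp ne_of_lt)).2 fun a => ?_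
  simp only [List.mem_map, List.mem_finRange, true_and, List.mem_filter, decide_eq_true_eq]
  exact Fin.exists_succAbove_eq_iff

theorem voteList_moveToTop (p : Preference (Fin m) m) (c : Fin m) :
    voteList (p.moveToTop c) =
      encodeNat (c : ℕ) :: (voteList p).filter fun w => !decide (w = encodeNat (c : ℕ)) := by
  have h := congrArg (List.map fun i => encodeNat (p.symm i : ℕ)) (map_cycleRange_symm (p c))
  rw [List.map_map, List.map_cons, Equiv.symm_apply_apply] at h
  refine h.trans ?_
  rw [voteList, List.filter_map]
  congr 2
  refine List.filter_congr fun i _ => ?_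
  simp [encodeNat_fin_inj, Equiv.symm_apply_eq]

open Classical in
theorem testVote_voteList (P : Profile (Fin n) (Fin m) m) (M : Finset (Fin n)) {x y : Fin m}
    (hyx : y ≠ x) (v : Fin n) :
    testVote (encodeNat (x : ℕ)) (encodeNat (y : ℕ)) (decide (v ∈ M), voteList (P v)) =
      voteList (replaceVotes P M (testVotes P M x y) v) := by
  by_cases hv : v ∈ M
  · simp only [testVote, hv, decide_true, cond_true, replaceVotes, dite_true, testVotes,
      voteList_moveToTop]
    rw [List.filter_cons_of_pos (by simpa [encodeNat_fin_inj] using hyx), List.filter_filter]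
    simp only [Bool.and_comm]
  · simp [testVote, hv, replaceVotes]

theorem intScore_ballots (z : Fin m → ℤ) (P : Profile (Fin n) (Fin m) m) (c : Fin m) :
    intScore (ballots ((List.finRange m).map fun i => signedWord (z i))
      ((List.finRange n).map fun v => voteList (P v))) (encodeNat (c : ℕ)) =
      ∑ v, z (P v c) := by
  have happ : ∀ (L L' : List (List Bool × List Bool)) (w : List Bool),
      intScore (L ++ L') w = intScore L w + intScore L' w := by
    intro L L' w
    simp [intScore]
  have hvote : ∀ p : Preference (Fin m) m,
      intScore ((voteList p).zip ((List.finRange m).map fun i => signedWord (z i)))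
        (encodeNat (c : ℕ)) = z (p c) := by
    intro p
    rw [voteList, List.zip_map', intScore, List.map_map]
    have : ∀ f : Fin m → ℤ, ((List.finRange m).map f).sum = ∑ i, f i := fun f => by
      rw [← List.ofFn_eq_map, List.sum_ofFn]
    rw [this]
    simp [encodeNat_fin_inj, signedVal_signedWord, Equiv.symm_apply_eq]
  have H : ∀ l : List (Fin n), intScore (ballots ((List.finRange m).map fun i => signedWord (z i))
      (l.map fun v => voteList (P v))) (encodeNat (c : ℕ)) =
      (l.map fun v => z (P v c)).sum := by
    intro l
    induction l with
    | nil => rfl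
    | cons v l ih =>
      rw [List.map_cons, ballots, List.flatMap_cons, happ, hvote, List.map_cons, List.sum_cons]
      exact congrArg _ ih
  rw [H, ← List.ofFn_eq_map, List.sum_ofFn]

/-- Multiplying all scores by `D > 0` preserves every comparison, and the earliest maximum along the
tie-breaking list is the winner of the rule. -/
theorem winner_ballots (I : CPMInput) (z : Fin I.m → ℤ) {D : ℝ} (hD : 0 < D)
    (hz : ∀ i, (z i : ℝ) = I.vector i * D) (P : Profile (Fin I.n) (Fin I.m) I.m) :
    winner (ballots ((List.finRange I.m).map fun i => signedWord (z i))
      ((List.finRange I.n).map fun v => voteList (P v))) (voteList I.tie) =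
      encodeNat (I.rule P : ℕ) := by
  have : Nonempty (Fin I.m) := ⟨⟨0, Nat.lt_of_lt_of_le Nat.two_pos I.isScoringVector.two_le⟩⟩
  have hrule := (scoringRule_eq_iff I.vector I.tie P (I.rule P)).1 rfl
  have hle : ∀ c d, totalScore I.vector P c ≤ totalScore I.vector P d ↔
      ∑ v, z (P v c) ≤ ∑ v, z (P v d) := by
    intro c d
    have : ∀ c, ((∑ v, z (P v c) : ℤ) : ℝ) = totalScore I.vector P c * D := by
      intro c
      simp [totalScore, Finset.sum_mul, hz]
    rw [← Int.cast_le (R := ℝ), this, this, mul_le_mul_iff_left₀ hD]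
  have hne : voteList I.tie ≠ [] := List.ne_nil_of_mem ((mem_voteList _).2 ⟨I.rule P, rfl⟩)
  refine Option.some_injective _ ((argmax_eq_winner _ hne).symm.trans ?_)
  rw [List.argmax_eq_some_iff]
  refine ⟨(mem_voteList _).2 ⟨_, rfl⟩, fun w hw => ?_, fun w hw h => ?_⟩
  · obtain ⟨c, rfl⟩ := (mem_voteList _).1 hw
    rw [intScore_ballots, intScore_ballots, ← hle]
    exact hrule.1 c
  · obtain ⟨c, rfl⟩ := (mem_voteList _).1 hw
    rw [intScore_ballots, intScore_ballots, ← hle] at h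
    rw [@idxOf_voteList _ instBEqOfDecidableEq, @idxOf_voteList _ instBEqOfDecidableEq]
    exact hrule.2 c h

open Classical in
theorem againstTest_iff (I : CPMInput) (hI : FirstGapMinimal I.vector) (z : Fin I.m → ℤ) {D : ℝ}
    (hD : 0 < D) (hz : ∀ i, (z i : ℝ) = I.vector i * D) (y : Fin I.m) :
    againstTest ((List.finRange I.m).map fun i => signedWord (z i)) (voteList I.tie)
      ((List.finRange I.n).map fun v => (decide (v ∈ I.M), voteList (I.profile v)))
      (encodeNat (y : ℕ)) = true ↔ IsCoalitionAgainst I.rule I.profile I.M y := by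
  have : Nonempty (Fin I.m) := ⟨y⟩
  by_cases hyx : y = I.rule I.profile
  · constructor
    · intro h
      simp [againstTest, List.map_map, Function.comp_def, winner_ballots I z hD hz, ← hyx] at h
    · exact fun h => absurd hyx h.1
  · have h1 : IsCoalitionAgainst I.rule I.profile I.M y ↔
        I.rule (replaceVotes I.profile I.M (testVotes I.profile I.M (I.rule I.profile) y)) = y :=
      isCoalitionAgainst_iff I.tie I.isScoringVector hI I.profile I.M rfl hyx
    simp only [againstTest, List.map_map, Function.comp_def, winner_ballots I z hD hz,
      testVote_voteList I.profile I.M hyx, h1]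
    simp [encodeNat_fin_inj, hyx]

end Votes

/-! ### Recovering the data of an instance from its symbols. -/

section Parsing

theorem chunks_append {l : List (Bool × Bool)} (h : ∀ e ∈ l, (e.1 || e.2) = true)
    (r : List (Bool × Bool)) : chunks (l ++ (false, false) :: r) = l :: chunks r := by
  induction l with
  | nil => rfl
  | cons e l ih =>
    have h1 := ih fun e he => h e (List.mem_cons_of_mem _ he)
    have h2 := h e List.mem_cons_self
    simp only [chunks, List.cons_append, List.foldr_cons] at h1 ⊢
    rw [h1, h2]
    rfl

theorem words_append (w : List Bool) (r : List (Bool × Bool)) :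
    words (w.map (fun b => (true, b)) ++ (false, true) :: r) = w :: words r := by
  induction w with
  | nil => rfl
  | cons b w ih =>
    simp only [words, List.map_cons, List.cons_append, List.foldr_cons] at ih ⊢
    rw [ih]
    rfl

/-- The symbols of a word, followed by a comma. -/
def wordSyms (w : List Bool) : List (Bool × Bool) := w.map (fun b => (true, b)) ++ [(false, true)]

theorem words_wordSyms_append (w : List Bool) (r : List (Bool × Bool)) :
    words (wordSyms w ++ r) = w :: words r := by
  rw [wordSyms, List.append_assoc, List.singleton_append, words_append]

theorem words_flatMap (l : List (List Bool)) : words (l.flatMap wordSyms) = l := by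
  induction l with
  | nil => rfl
  | cons w l ih => rw [List.flatMap_cons, words_wordSyms_append, ih]

theorem wordSyms_ne {w : List Bool} {e : Bool × Bool} (h : e ∈ wordSyms w) :
    (e.1 || e.2) = true := by
  simp only [wordSyms, List.mem_append, List.mem_map, List.mem_singleton] at h
  rcases h with ⟨b, -, rfl⟩ | rfl <;> rfl

theorem flatMap_wordSyms_ne {l : List (List Bool)} : ∀ e ∈ l.flatMap wordSyms,
    (e.1 || e.2) = true := by
  intro e he
  obtain ⟨w, -, hw⟩ := List.mem_flatMap.1 he
  exact wordSyms_ne hw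

theorem map_symPair_nat (k : ℕ) : (Encode.nat k).map symPair = wordSyms (encodeNat k) := by
  simp [Encode.nat, wordSyms, symPair, Function.comp_def]

theorem map_symPair_int (z : ℤ) : (Encode.int z).map symPair = wordSyms (signedWord z) := by
  rw [Encode.int, List.map_cons, map_symPair_nat]
  rfl

theorem map_symPair_preference {m : ℕ} (p : Preference (Fin m) m) :
    (Encode.preference p).map symPair = (voteList p).flatMap wordSyms ++ [(false, false)] := by
  simp [Encode.preference, List.map_flatMap, map_symPair_nat, voteList, List.flatMap_map,
    symPair]

theorem map_symPair_ratVector {m : ℕ} (q : Fin m → ℚ) :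
    (Encode.ratVector q).map symPair = (encodeNat (Encode.commonDen q) ::
      (List.finRange m).map fun i => signedWord (q i * Encode.commonDen q).num).flatMap wordSyms ++
        [(false, false)] := by
  simp [Encode.ratVector, List.map_flatMap, map_symPair_nat, map_symPair_int, List.flatMap_map,
    symPair]

/-- The symbols of the flag and the vote of a voter. -/
def voterSyms (v : Bool × List (List Bool)) : List (Bool × Bool) :=
  (true, v.1) :: v.2.flatMap wordSyms

theorem parseVoter_voterSyms (v : Bool × List (List Bool)) : parseVoter (voterSyms v) = v := by
  simp [parseVoter, voterSyms, words_flatMap]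

theorem chunks_voters (l : List (Bool × List (List Bool))) :
    chunks (l.flatMap fun v => voterSyms v ++ [(false, false)]) = l.map voterSyms := by
  induction l with
  | nil => rfl
  | cons v l ih =>
    rw [List.flatMap_cons, List.append_assoc, List.singleton_append, chunks_append, ih,
      List.map_cons]
    intro e he
    rcases List.mem_cons.1 he with rfl | he
    · rfl
    · exact flatMap_wordSyms_ne e he

/-- The numerators of the scores. -/
def numerators (I : CPMInput) (i : Fin I.m) : ℤ := (I.scores i * Encode.commonDen I.scores).num

theorem commonDen_pos {m : ℕ} (q : Fin m → ℚ) : 0 < Encode.commonDen q := by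
  refine Nat.pos_of_ne_zero fun h => ?_
  obtain ⟨i, -, hi⟩ := Finset.lcm_eq_zero_iff.1 h
  exact (q i).den_ne_zero hi

/-- Each denominator divides the common one, so the product is an integer and passing to its
numerator loses nothing. -/
theorem numerators_eq (I : CPMInput) (i : Fin I.m) :
    (numerators I i : ℝ) = I.vector i * Encode.commonDen I.scores := by
  have hden : (I.scores i * Encode.commonDen I.scores).den = 1 := by
    obtain ⟨k, hk⟩ : (I.scores i).den ∣ Encode.commonDen I.scores :=
      Finset.dvd_lcm (Finset.mem_univ i)
    have : I.scores i * Encode.commonDen I.scores = ((I.scores i).num * k : ℤ) := by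
      rw [hk]
      push_cast
      rw [← mul_assoc, Rat.mul_den_eq_num]
    rw [this, Rat.den_intCast]
  have h := Rat.coe_int_num_of_den_eq_one hden
  have := congrArg (Rat.cast (K := ℝ)) h
  push_cast at this
  exact this

open Classical in
/-- The flags and the votes of all voters. -/
noncomputable def voterList (I : CPMInput) : List (Bool × List (List Bool)) :=
  (List.finRange I.n).map fun v => (decide (v ∈ I.M), voteList (I.profile v))

theorem map_symPair_cpm (I : CPMInput) :
    (Encode.cpm I).map symPair = (encodeNat (Encode.commonDen I.scores) ::
      (List.finRange I.m).map fun i => signedWord (numerators I i)).flatMap wordSyms ++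
        (false, false) :: ((voteList I.tie).flatMap wordSyms ++ (false, false) ::
          (voterList I).flatMap fun v => voterSyms v ++ [(false, false)]) := by
  rw [Encode.cpm, List.map_append, List.map_append, map_symPair_ratVector, map_symPair_preference]
  simp only [List.append_assoc, List.cons_append, List.nil_append, numerators]
  congr 4
  rw [List.map_flatMap, voterList, List.flatMap_map]
  refine List.flatMap_congr fun v _ => ?_
  rw [List.map_cons, map_symPair_preference]
  simp [voterSyms, symPair]

/-- The tie-breaking list contains every candidate, so running through it tries all possible `y`. -/
theorem decideCPM_iff (I : CPMInput) (hI : FirstGapMinimal I.vector) :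
    decideCPM ((Encode.cpm I).map symPair) = true ↔ CPM I := by
  have key := againstTest_iff I hI (numerators I)
    (Nat.cast_pos.2 (commonDen_pos I.scores)) (numerators_eq I)
  rw [decideCPM, map_symPair_cpm, chunks_append flatMap_wordSyms_ne,
    List.tail_cons, chunks_append flatMap_wordSyms_ne, chunks_voters]
  simp only [List.headD_cons, List.tail_cons, words_flatMap, List.map_map, Function.comp_def,
    parseVoter_voterSyms, List.map_id', List.any_eq_true]
  constructor
  · rintro ⟨w, hw, h⟩
    obtain ⟨y, rfl⟩ := (mem_voteList _).1 hw
    exact ⟨y, (key y).1 h⟩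
  · rintro ⟨y, h⟩
    exact ⟨_, (mem_voteList _).2 ⟨y, rfl⟩, (key y).2 h⟩

theorem decideCPMW_iff (I : CPMWInput) (hI : FirstGapMinimal I.vector) :
    decideCPMW ((Encode.cpmw I).map symPair) = true ↔ CPMW I := by
  have key := againstTest_iff I.toCPMInput hI (numerators I.toCPMInput)
    (Nat.cast_pos.2 (commonDen_pos I.scores)) (numerators_eq I.toCPMInput) I.y
  -- No end marker follows the word of `y`, so it belongs to the first chunk, ahead of the
  -- denominator; hence the two tails in front of the scores.
  rw [decideCPMW, Encode.cpmw, List.map_append, map_symPair_nat, map_symPair_cpm,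
    ← List.append_assoc, ← List.flatMap_cons, chunks_append flatMap_wordSyms_ne,
    List.tail_cons, chunks_append flatMap_wordSyms_ne, chunks_voters]
  simp only [List.headD_cons, List.tail_cons, words_flatMap, List.map_map, Function.comp_def,
    parseVoter_voterSyms, List.map_id']
  exact key

end Parsing

end StackLang

theorem mainTheorem2 :
    -- correctness of the test, for all real scoring vectors of the class
    (∀ (V C : Type*) [Fintype V] [Fintype C] [Nonempty C] (m : ℕ) (α : Fin m → ℝ)
        (t : Preference C m), IsScoringVector α → FirstGapMinimal α →
        ∀ (P : Profile V C m) (M : Finset V) (x y : C), scoringRule α t P = x → y ≠ x →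
          (IsCoalitionAgainst (scoringRule α t) P M y ↔
            scoringRule α t (replaceVotes P M (testVotes P M x y)) = y)) ∧
    -- CPMW and CPM are in P for the class
    InP (fun I : {I : CPMWInput // FirstGapMinimal I.vector} => Encode.cpmw I.1)
      (fun I => CPMW I.1) ∧
    InP (fun I : {I : CPMInput // FirstGapMinimal I.vector} => Encode.cpm I.1)
      (fun I => CPM I.1) ∧
    -- the class contains the Borda rule
    (∀ m : ℕ, 2 ≤ m → IsScoringVector (bordaVector m) ∧ FirstGapMinimal (bordaVector m)) := by
  refine ⟨fun V C _ _ _ m α t hα hgap P M x y hx hyx =>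
    isCoalitionAgainst_iff t hα hgap P M hx hyx, ?_, ?_,
    fun m hm => ⟨isScoringVector_bordaVector hm, firstGapMinimal_bordaVector m⟩⟩
  -- Reading the input onto a stack reverses it, which is undone before the procedure starts.
  · refine StackLang.inP_of_polyTime
      (StackLang.PolyTime.decideCPMW.comp (StackLang.PolyTime.reverse StackLang.PolyTime.id'))
      fun I => ?_
    rw [List.reverse_reverse]
    exact StackLang.decideCPMW_iff I.1 I.2
  · refine StackLang.inP_of_polyTime
      (StackLang.PolyTime.decideCPM.comp (StackLang.PolyTime.reverse StackLang.PolyTime.id'))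
      fun I => ?_
    rw [List.reverse_reverse]
    exact StackLang.decideCPM_iff I.1 I.2
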